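/- **Setting.** Let $d\ge 1$, $\beta\in[-1,1]^d$, and let $C_1,\dots,C_T\subset[-1,1]^d$ be finite choice sets. In round $t$ an algorithm picks a random set $P_t\subseteq C_t$, drawn from a distribution $\pi_t$ that depends only on the choice sets and on the picks and rewards observed before round $t$, and then observes for every $x\in P_t$ a reward $y_{t,x}\in[-1,1]$ with $\mathbb E\,y_{t,x}=\langle\beta,x\rangle$ (so its noise is $1$-sub-Gaussian); the rewards of a round are independent of each other and of everything picked or observed before they are revealed. **Algorithm.** $\mathrm{RidgeFair}_m$ has parameters $\delta\in(0,1]$ and $\gamma\ge1$ and a mode (exact or not). In round $t$ let $V_t=\gamma I+\sum_{s<t}\sum_{x\in P_s}xx^{\top}$, $\hat\beta_t=V_t^{-1}\sum_{s<t}\sum_{x\in P_s}y_{s,x}x$, and give every $x\in C_t$ the confidence interval $[\langle\hat\beta_t,x\rangle-w_{t,x},\ \langle\hat\beta_t,x\rangle+w_{t,x}]$ with $$w_{t,x}=\sqrt{x^{\top}V_t^{-1}x}\,\Bigl(\sqrt{2d\log\tfrac{1+mt/\gamma}{\delta}}+\sqrt\gamma\Bigr).$$ Two arms of $C_t$ are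 linked if their intervals intersect, and chained if they are joined by a finite sequence of consecutively linked arms of $C_t$. Starting from $P_t=\emptyset$, as long as $|P_t|<m$ and arms are left, take the chain $S$ of the arm with the highest upper confidence bound among the arms not yet selected; if $|S|\le m-|P_t|$ add all of $S$ to $P_t$, otherwise add a uniformly random subset of $S$ of size $m-|P_t|$. In the non-exact mode also stop as soon as the highest remaining upper confidence bound is not positive. **Theorem.** Assume that $\gamma=1$ or $\|\beta\|_2\le1$. 1. (Fairness.) For every $m$ and in both modes, $\mathrm{RidgeFair}_m$ is weakly meritocratically fair: with probability at least $1-\delta$, in every round $t\le T$ and for all $x,x'\in C_t$ with $\langle\beta,x\rangle\ge\langle\beta,x'\rangle$, one has $\Pr_{A\sim\pi_t}[x\in A]\ge\Pr_{A\sim\pi_t}[x'\in A]$. 2. (Regret.) There is a universal constant $K$ such that the following holds whenever $|C_t|\le k$ for all $t$. * Exactly $m$ arms: if $m\le|C_t|$ for all $t$, then the pseudo-regret $R=\sum_{t=1}^T\bigl(\max_{A\subseteq C_t,\,|A|=m}\sum_{x\in A}\langle\beta,x\rangle-\sum_{x\in P_t}\langle\beta,x\rangle\bigr)$ of $\mathrm{RidgeFair}_m$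 in exact mode satisfies, with probability at least $1-\delta$, $$R\le K\,d\,k\,m\sqrt{\gamma T}\,\log\frac{1+mT}{\delta}.$$ In particular, for $\gamma=1$, it is $\tilde O(dkm\sqrt T)$, and $\tilde O(dk\sqrt T)$ for $m=1$. * Unconstrained: the pseudo-regret $R=\sum_{t=1}^T\bigl(\max_{A\subseteq C_t}\sum_{x\in A}\langle\beta,x\rangle-\sum_{x\in P_t}\langle\beta,x\rangle\bigr)$ of $\mathrm{RidgeFair}_k$ in non-exact mode satisfies, with probability at least $1-\delta$, $$R\le K\,d\,k^2\sqrt{\gamma T}\,\log\frac{1+kT}{\delta},$$ which is $\tilde O(dk^2\sqrt T)$ for $\gamma=1$. In both cases the same bound holds for $\mathbb E[R]$ if $\delta\le1/\sqrt T$. -/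

import Mathlib

open MeasureTheory ProbabilityTheory Matrix

noncomputable section

namespace FairBandit

/-! ### Chaining of confidence intervals and the picking procedures -/

section Pick

variable {α : Type*}

/-- Two arms are linked if their confidence intervals `[lo, up]` intersect. -/
def Linked (lo up : α → ℝ) (x y : α) : Prop :=
  (Set.Icc (lo x) (up x) ∩ Set.Icc (lo y) (up y)).Nonempty

/-- Two arms of the choice set `C` are chained if they are joined by a finite sequence of
consecutively linked arms of `C`. -/
def Chained (C : Finset α) (lo up : α → ℝ) : α → α → Prop :=
  Relation.ReflTransGen (fun x y => x ∈ C ∧ y ∈ C ∧ Linked lo up x y)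

open Classical in
/-- The set of all arms of `C` that are chained to `x`. -/
def chain (C : Finset α) (lo up : α → ℝ) (x : α) : Finset α :=
  C.filter (fun y => Chained C lo up x y)

theorem self_mem_chain {C : Finset α} (lo up : α → ℝ) {x : α} (hx : x ∈ C) :
    x ∈ chain C lo up x := by
  classical
  exact Finset.mem_filter.2 ⟨hx, Relation.ReflTransGen.refl⟩

/-- The loop of the picking procedure, started with the partial selection `P`; the arms not yet
selected are `C \ P`.  As long as fewer than `m` arms are selected and arms are left, the chain `S`
of an arm with the highest upper confidence bound among the arms left is treated: it is taken
entirely if it fits, and otherwise the remaining capacity is filled by a uniformly random subset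
of `S`.  If `exact = false`, the loop also stops as soon as the highest upper confidence bound left
is not positive.  The result is the distribution of the selected set.  (Arms with equal upper
confidence bounds are linked, so the choice among several maximizers is immaterial.) -/
def pickLoop [DecidableEq α] (m : ℕ) (exact : Bool) (C : Finset α) (lo up : α → ℝ) (P : Finset α) :
    PMF (Finset α) := by
  classical
  exact
    if h : P.card < m ∧
        ∃ x ∈ C \ P, (∀ y ∈ C \ P, up y ≤ up x) ∧ (exact = true ∨ 0 < up x) then
      if hS : (chain C lo up h.2.choose).card ≤ m - P.card then
        pickLoop m exact C lo up (P ∪ chain C lo up h.2.choose)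
      else
        (PMF.uniformOfFinset ((chain C lo up h.2.choose).powersetCard (m - P.card))
          (Finset.powersetCard_nonempty.2 (le_of_not_ge hS))).map (fun Q => P ∪ Q)
    else PMF.pure P
termination_by (C \ P).card
decreasing_by
  have hx := h.2.choose_spec.1
  apply Finset.card_lt_card
  rw [Finset.ssubset_iff_of_subset
    (Finset.sdiff_subset_sdiff (Finset.Subset.refl C) Finset.subset_union_left)]
  refine ⟨_, hx, fun hn => ?_⟩
  refine (Finset.mem_sdiff.1 hn).2 (Finset.mem_union_right _ ?_)
  exact self_mem_chain lo up (Finset.mem_sdiff.1 hx).1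

/-- The distribution of the set picked from `C`: exactly `m` arms if `exact = true`
(and `C` has at least `m` arms), at most `m` arms if `exact = false`. -/
def pick [DecidableEq α] (m : ℕ) (exact : Bool) (C : Finset α) (lo up : α → ℝ) : PMF (Finset α) :=
  pickLoop m exact C lo up ∅

/-- The probability that `x` belongs to the set drawn from `π`. -/
def marginal (π : PMF (Finset α)) (x : α) : ENNReal :=
  π.toOuterMeasure {A | x ∈ A}

end Pick

/-! ### The algorithm RidgeFair

Rounds are numbered `0, 1, 2, …`, so that round `t` here is the `(t + 1)`-st round.  The data
are the sets `P s` picked and the rewards `y s x` of the arms `x ∈ P s`, for the rounds `s < t`;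
`C t` is the choice set of round `t`. -/

variable {d : ℕ}

/-- `V = XᵀX + γ I`, where the rows of `X` are the arms picked before round `t`. -/
def gram (γ : ℝ) (P : ℕ → Finset (Fin d → ℝ)) (t : ℕ) : Matrix (Fin d) (Fin d) ℝ :=
  (∑ s ∈ Finset.range t, ∑ x ∈ P s, vecMulVec x x) + γ • (1 : Matrix (Fin d) (Fin d) ℝ)

/-- The regularized least squares estimator `V⁻¹ Xᵀ Y` before round `t`. -/
def ridge (γ : ℝ) (P : ℕ → Finset (Fin d → ℝ)) (y : ℕ → (Fin d → ℝ) → ℝ) (t : ℕ) :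
    Fin d → ℝ :=
  (gram γ P t)⁻¹ *ᵥ (∑ s ∈ Finset.range t, ∑ x ∈ P s, y s x • x)

/-- Half the width of the confidence interval of the arm `x` in round `t`: the norm of `x` with
respect to `V⁻¹`, times `√(2 d log ((1 + m (t + 1) / γ) / δ)) + √γ`. -/
def width (m : ℕ) (γ δ : ℝ) (P : ℕ → Finset (Fin d → ℝ)) (t : ℕ) (x : Fin d → ℝ) : ℝ :=
  √(x ⬝ᵥ (gram γ P t)⁻¹ *ᵥ x) *
    (√(2 * d * Real.log ((1 + m * (t + 1) / γ) / δ)) + √γ)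

/-- A (randomized) policy: from the choice sets, the sets picked and the rewards observed before
round `t`, it produces the distribution of the set to be picked in round `t`. -/
abbrev Policy (d : ℕ) : Type :=
  (C : ℕ → Finset (Fin d → ℝ)) → (P : ℕ → Finset (Fin d → ℝ)) → (y : ℕ → (Fin d → ℝ) → ℝ) →
    (t : ℕ) → PMF (Finset (Fin d → ℝ))

/-- RidgeFair: pick by chains of the ridge regression confidence intervals. -/
def ridgeFair (m : ℕ) (exact : Bool) (γ δ : ℝ) : Policy d := fun C P y t =>
  pick m exact (C t)
    (fun x => ridge γ P y t ⬝ᵥ x - width m γ δ P t x)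
    (fun x => ridge γ P y t ⬝ᵥ x + width m γ δ P t x)

/-! ### The interaction of a policy with the linear bandit -/

section Interaction

variable {Ω : Type*} [MeasurableSpace Ω]

/-- The σ-algebra generated by everything observed before round `t`: the sets picked and the
rewards of the arms picked. -/
@[reducible] def history (C : ℕ → Finset (Fin d → ℝ)) (P : ℕ → Ω → Finset (Fin d → ℝ))
    (Y : ℕ → (Fin d → ℝ) → Ω → ℝ) (t : ℕ) : MeasurableSpace Ω :=
  ⨆ s ∈ Finset.range t,
    (MeasurableSpace.comap (P s) ⊤ ⊔
      ⨆ x ∈ C s, MeasurableSpace.comap (fun ω => if x ∈ P s ω then Y s x ω else 0) inferInstance)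

/-- The random sets `P t` and rewards `Y t x`, `t < T`, describe `T` rounds of the policy `π` in
the linear bandit with coefficients `β` and choice sets `C t`.  `Y t x` is the reward that the arm
`x ∈ C t` yields if it is picked in round `t`; it lies in `[-1, 1]` (so that its noise is
`1`-sub-Gaussian), has mean `⟨β, x⟩`, and the rewards of a round are independent of each other and of
all that was observed or picked before they are revealed.  Given the observations before round `t`,
the set `P t` is drawn from the distribution chosen by the policy. -/
structure IsInteraction (π : Policy d) (β : Fin d → ℝ) (T : ℕ) (C : ℕ → Finset (Fin d → ℝ))
    (μ : Measure Ω) (P : ℕ → Ω → Finset (Fin d → ℝ)) (Y : ℕ → (Fin d → ℝ) → Ω → ℝ) : Prop where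
  pick_measurable : ∀ t < T, ∀ A : Finset (Fin d → ℝ), MeasurableSet {ω | P t ω = A}
  pick_subset : ∀ t < T, ∀ ω, P t ω ⊆ C t
  reward_measurable : ∀ t < T, ∀ x ∈ C t, Measurable (Y t x)
  reward_mem : ∀ t < T, ∀ x ∈ C t, ∀ᵐ ω ∂μ, Y t x ω ∈ Set.Icc (-1 : ℝ) 1
  reward_mean : ∀ t < T, ∀ x ∈ C t, ∫ ω, Y t x ω ∂μ = β ⬝ᵥ x
  reward_indep : ∀ t < T, iIndepFun (fun x : C t => Y t x) μ
  reward_indep_past : ∀ t < T,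
    Indep (⨆ x ∈ C t, MeasurableSpace.comap (Y t x) inferInstance)
      (history C P Y t ⊔ MeasurableSpace.comap (P t) ⊤) μ
  pick_law : ∀ t < T, ∀ A : Finset (Fin d → ℝ),
    μ[Set.indicator {ω | P t ω = A} (fun _ => (1 : ℝ)) | history C P Y t] =ᵐ[μ]
      fun ω => (π C (fun s => P s ω) (fun s x => Y s x ω) t A).toReal

end Interaction

/-! ### Fairness and regret -/

/-- A distribution over subsets of the choice set `C` is round-fair if a better arm is always
picked with at least the probability of a worse arm. -/
def RoundFair (β : Fin d → ℝ) (C : Finset (Fin d → ℝ)) (π : PMF (Finset (Fin d → ℝ))) : Prop :=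
  ∀ x ∈ C, ∀ x' ∈ C, β ⬝ᵥ x' ≤ β ⬝ᵥ x → marginal π x' ≤ marginal π x

/-- The policy is round-fair in every round `t < T` of the run with picks `P` and rewards `y`. -/
def FairRun (π : Policy d) (β : Fin d → ℝ) (T : ℕ) (C P : ℕ → Finset (Fin d → ℝ))
    (y : ℕ → (Fin d → ℝ) → ℝ) : Prop :=
  ∀ t < T, RoundFair β (C t) (π C P y t)

/-- The expected reward of picking the set `A`. -/
def setReward (β : Fin d → ℝ) (A : Finset (Fin d → ℝ)) : ℝ := ∑ x ∈ A, β ⬝ᵥ x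

/-- The best expected reward of a set of exactly `m` arms of `C`. -/
def bestExact (β : Fin d → ℝ) (m : ℕ) (C : Finset (Fin d → ℝ)) : ℝ :=
  sSup (setReward β '' {A | A ⊆ C ∧ A.card = m})

/-- The best expected reward of an arbitrary set of arms of `C`. -/
def bestUnconstrained (β : Fin d → ℝ) (C : Finset (Fin d → ℝ)) : ℝ :=
  sSup (setReward β '' {A | A ⊆ C})

/-- The pseudo-regret over `T` rounds of the picks `P` with respect to the benchmark `best`. -/
def regret (β : Fin d → ℝ) (best : Finset (Fin d → ℝ) → ℝ) (T : ℕ)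
    (C P : ℕ → Finset (Fin d → ℝ)) : ℝ :=
  ∑ t ∈ Finset.range T, (best (C t) - setReward β (P t))

/-- The bound `B` holds for the random pseudo-regret `R` over `T` rounds with probability at least
`1 - δ`, and it holds for the expected pseudo-regret as soon as `δ ≤ 1 / √T`. -/
def RegretAtMost {Ω : Type*} [MeasurableSpace Ω] (μ : Measure Ω) (R : Ω → ℝ) (T : ℕ) (δ B : ℝ) :
    Prop :=
  μ {ω | B < R ω} ≤ ENNReal.ofReal δ ∧
    (δ * √T ≤ 1 → Integrable R μ ∧ ∫ ω, R ω ∂μ ≤ B)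

end FairBandit

end

open MeasureTheory ProbabilityTheory Matrix

noncomputable section

namespace FairBandit

/-! ### The picking procedure -/

section PickStructure

variable {α : Type*} {C : Finset α} {lo up : α → ℝ}

/-! Everything rests on one event: in all rounds the confidence intervals contain the true means. If
`⟨β,x'⟩ ≤ ⟨β,x⟩`, this event forces `lo x' ≤ up x`. The procedure selects a set lying strictly above
all remaining arms, possibly completed by a uniform part of the next chain. Such top sets are closed
under passing from `x'` to `x`, so the marginals are ordered as required (`marginal_pick_le`).
Fairness thus needs no probability beyond the confidence event.

The confidence event comes from the method of mixtures. For each direction `u` the exponential of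
`logWeight` is a nonnegative supermartingale, by Hoeffding's lemma and the independence of the
rewards. Integrating over `u` gives an explicit Gaussian integral, and Ville's inequality bounds it
uniformly in time (`measure_residual_le`). The Gaussian weight is centered at `-β`, so the ridge
bias is treated together with the noise. The determinant that appears is bounded by its trace, and
`deviation_le_sq_width` checks that the width dominates the result.

For the regret, the intervals of a chain cover the gap between its best upper end and any of its
lower ends, so every arm of a chain misses the threshold by at most the total length of the chain.
In the unconstrained mode a treated chain is picked entirely, so this length is paid by picked arms.
In the exact mode the last chain is picked only in part; since each of its arms has the same
probability, its total length is still controlled by the expected width of the picked arms, at the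
price of a factor `k`. A multiplicative concentration inequality (`measure_sum_condMean_le`)
replaces these conditional expectations by realized sums. The realized widths are summed by the
elliptical potential lemma for batches and Cauchy-Schwarz (`sum_min_one_width_le`). Means lie in
`[-1,1]`, so widths can be truncated at `1` throughout. -/

theorem linked_iff {x y : α} (hx : lo x ≤ up x) (hy : lo y ≤ up y) :
    Linked lo up x y ↔ lo x ≤ up y ∧ lo y ≤ up x := by
  constructor
  · rintro ⟨r, hr1, hr2⟩
    exact ⟨hr1.1.trans hr2.2, hr2.1.trans hr1.2⟩
  · rintro ⟨h1, h2⟩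
    exact ⟨max (lo x) (lo y), ⟨le_max_left _ _, max_le hx h2⟩, ⟨le_max_right _ _, max_le h1 hy⟩⟩

theorem mem_chain {z x : α} : x ∈ chain C lo up z ↔ x ∈ C ∧ Chained C lo up z x := by
  classical
  exact Finset.mem_filter

theorem chain_subset (z : α) : chain C lo up z ⊆ C := fun _ hx => (mem_chain.1 hx).1

/-- A subset of `C` whose intervals all lie strictly above the intervals of the other arms. -/
def IsTop (C : Finset α) (lo up : α → ℝ) (F : Finset α) : Prop :=
  F ⊆ C ∧ ∀ x ∈ F, ∀ y ∈ C, y ∉ F → up y < lo x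

theorem isTop_empty : IsTop C lo up ∅ := ⟨by simp, by simp⟩

/-- The strict gap below a top set admits no link across it, so no chain can enter from outside. -/
theorem IsTop.not_mem_of_chained {F : Finset α} (hF : IsTop C lo up F) {z x : α} (hzF : z ∉ F)
    (h : Chained C lo up z x) : x ∉ F := by
  induction h with
  | refl => exact hzF
  | @tail b c _ hbc ih =>
    intro hc
    obtain ⟨r, hr1, hr2⟩ := hbc.2.2
    exact absurd (hF.2 c hc b hbc.1 ih) (not_lt.2 (hr2.1.trans hr1.2))

theorem IsTop.disjoint_chain {F : Finset α} (hF : IsTop C lo up F) {z : α} (hzF : z ∉ F) :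
    Disjoint F (chain C lo up z) :=
  Finset.disjoint_right.2 fun _ hx => hF.not_mem_of_chained hzF (mem_chain.1 hx).2

/-- An arm `y` outside the chain is linked to none of its members, so each member lies entirely
above or entirely below `y`. The starting arm cannot lie below, because its upper end is maximal,
and a link cannot jump over the interval of `y`. -/
theorem IsTop.lt_of_mem_chain {F : Finset α} (hlo : ∀ x, lo x ≤ up x) {z : α}
    (hzC : z ∈ C) (hz : ∀ y ∈ C, y ∉ F → up y ≤ up z) {x y : α}
    (hx : x ∈ chain C lo up z) (hyC : y ∈ C) (hyF : y ∉ F) (hy : y ∉ chain C lo up z) :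
    up y < lo x := by
  have key : ∀ x, Chained C lo up z x → x ∈ C ∧ up y < lo x := by
    intro x hx
    have notLinked : ∀ x, x ∈ C → Chained C lo up z x → up y < lo x ∨ up x < lo y := by
      intro x hxC hx
      by_contra hcon
      push Not at hcon
      exact hy (mem_chain.2 ⟨hyC, hx.tail ⟨hxC, hyC, (linked_iff (hlo x) (hlo y)).2 hcon⟩⟩)
    induction hx with
    | refl =>
      refine ⟨hzC, (notLinked z hzC .refl).resolve_right fun h => ?_⟩
      linarith [hz y hyC hyF, hlo y]
    | @tail b c hzb hbc ih =>
      refine ⟨hbc.2.1, (notLinked c hbc.2.1 (hzb.tail hbc)).resolve_right fun h => ?_⟩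
      linarith [((linked_iff (hlo b) (hlo c)).1 hbc.2.2).1, hlo y, ih.2]
  exact (key x (mem_chain.1 hx).2).2

/-- This is the loop invariant: adding the chain of a maximal remaining arm keeps the selection a
top set. -/
theorem IsTop.union_chain [DecidableEq α] {F : Finset α} (hlo : ∀ x, lo x ≤ up x)
    (hF : IsTop C lo up F) {z : α} (hzC : z ∈ C) (hz : ∀ y ∈ C, y ∉ F → up y ≤ up z) :
    IsTop C lo up (F ∪ chain C lo up z) := by
  refine ⟨Finset.union_subset hF.1 (chain_subset z), fun x hx y hyC hy => ?_⟩
  rw [Finset.mem_union, not_or] at hy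
  rcases Finset.mem_union.1 hx with hx | hx
  · exact hF.2 x hx y hyC hy.1
  · exact IsTop.lt_of_mem_chain hlo hzC hz hx hyC hy.1 hy.2

/-- The gap between the upper end of an arm and the lower end of an arm of its chain is at most the
total length of the intervals of the chain. -/
theorem up_sub_lo_le_sum_chain (hlo : ∀ x, lo x ≤ up x) {z x : α} (hzC : z ∈ C)
    (hx : x ∈ chain C lo up z) : up z - lo x ≤ ∑ y ∈ chain C lo up z, (up y - lo y) := by
  have key : ∀ x, Chained C lo up z x → x ∈ C ∧
      Set.Icc (lo x) (up z) ⊆ ⋃ y ∈ chain C lo up z, Set.Icc (lo y) (up y) := by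
    intro x hx
    induction hx with
    | refl => exact ⟨hzC, fun r hr => Set.mem_biUnion (self_mem_chain lo up hzC) hr⟩
    | @tail b c hzb hbc ih =>
      refine ⟨hbc.2.1, fun r hr => ?_⟩
      by_cases h : lo b ≤ r
      · exact ih.2 ⟨h, hr.2⟩
      · refine Set.mem_biUnion (x := c) (mem_chain.2 ⟨hbc.2.1, hzb.tail hbc⟩) ⟨hr.1, ?_⟩
        linarith [((linked_iff (hlo b) (hlo c)).1 hbc.2.2).1]
  have h1 := (measure_mono (μ := volume) (key x (mem_chain.1 hx).2).2).trans
    (measure_biUnion_finset_le _ _)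
  simp only [Real.volume_Icc] at h1
  rw [← ENNReal.ofReal_sum_of_nonneg fun y _ => sub_nonneg.2 (hlo y)] at h1
  exact (ENNReal.ofReal_le_ofReal_iff (Finset.sum_nonneg fun y _ => sub_nonneg.2 (hlo y))).1 h1

/-- Every arm of `F` lies in a chain contained in `F` and started by an arm with a positive upper
confidence bound. -/
def PositiveChains (C : Finset α) (lo up : α → ℝ) (F : Finset α) : Prop :=
  ∀ x ∈ F, ∃ z ∈ C, x ∈ chain C lo up z ∧ 0 < up z ∧ chain C lo up z ⊆ F

/-- The truncated spread of the values in a chain. -/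
theorem min_up_one_sub_le {v w : α → ℝ} (hw : ∀ x, up x - lo x = 2 * w x) (hw0 : ∀ x, 0 ≤ w x)
    (hv1 : ∀ x ∈ C, |v x| ≤ 1) (hv : ∀ x ∈ C, lo x ≤ v x) {z x : α} (hzC : z ∈ C)
    (hx : x ∈ chain C lo up z) :
    min (up z) 1 - v x ≤ 2 * ∑ y ∈ chain C lo up z, min 1 (w y) := by
  have hlo : ∀ x, lo x ≤ up x := fun x => by linarith [hw x, hw0 x]
  have hxC := chain_subset z hx
  have h1 := up_sub_lo_le_sum_chain hlo hzC hx
  simp only [hw, ← Finset.mul_sum] at h1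
  have h2 := (abs_le.1 (hv1 x hxC)).1
  have h3 := hv x hxC
  have hnn : ∀ y ∈ chain C lo up z, 0 ≤ min 1 (w y) := fun y _ => le_min zero_le_one (hw0 y)
  -- If some half-width exceeds `1`, the right side is at least `2`, while the left side is at most
  -- `1 - (-1)`. Otherwise the truncation is void and the covering bound applies.
  by_cases hall : ∀ y ∈ chain C lo up z, w y ≤ 1
  · have : ∑ y ∈ chain C lo up z, min 1 (w y) = ∑ y ∈ chain C lo up z, w y :=
      Finset.sum_congr rfl fun y hy => min_eq_right (hall y hy)
    rw [this]
    linarith [min_le_left (up z) 1]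
  · push Not at hall
    obtain ⟨y, hy, hy1⟩ := hall
    have := Finset.single_le_sum hnn hy
    rw [min_eq_left hy1.le] at this
    linarith [min_le_right (up z) 1]

theorem marginal_pure_of_mem {F : Finset α} {x : α} (hx : x ∈ F) :
    marginal (PMF.pure F) x = 1 := by
  classical
  simp [marginal, PMF.toOuterMeasure_pure_apply, hx]

theorem marginal_pure_of_not_mem {F : Finset α} {x : α} (hx : x ∉ F) :
    marginal (PMF.pure F) x = 0 := by
  classical
  simp [marginal, PMF.toOuterMeasure_pure_apply, hx]

variable [DecidableEq α]

/-- The loop ends with a deterministic top set, or with a top set completed by a uniformly random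
subset of the next chain. -/
theorem pickLoop_cases (m : ℕ) (exact : Bool) (hlo : ∀ x, lo x ≤ up x) (P : Finset α)
    (hP : IsTop C lo up P) (hPm : P.card ≤ m) (hpos : exact = false → PositiveChains C lo up P) :
    ∃ F, IsTop C lo up F ∧ F.card ≤ m ∧ (exact = false → PositiveChains C lo up F) ∧
      ((pickLoop m exact C lo up P = PMF.pure F ∧
        (F.card = m ∨ ∀ y ∈ C, y ∉ F → exact = false ∧ up y ≤ 0)) ∨
      ∃ z ∈ C, z ∉ F ∧ (∀ y ∈ C, y ∉ F → up y ≤ up z) ∧ m - F.card < (chain C lo up z).card ∧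
        F.card < m ∧
        ∃ hne : ((chain C lo up z).powersetCard (m - F.card)).Nonempty,
        pickLoop m exact C lo up P =
          (PMF.uniformOfFinset ((chain C lo up z).powersetCard (m - F.card)) hne).map
            (fun Q => F ∪ Q)) := by
  induction hn : (C \ P).card using Nat.strong_induction_on generalizing P with
  | _ n ih =>
  by_cases h : P.card < m ∧
      ∃ x ∈ C \ P, (∀ y ∈ C \ P, up y ≤ up x) ∧ (exact = true ∨ 0 < up x)
  · have hspec := h.2.choose_spec
    rw [pickLoop, dif_pos h]
    set z := h.2.choose with hzdef
    obtain ⟨hzCP, hzmax, hzpos⟩ := hspec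
    rw [Finset.mem_sdiff] at hzCP
    have hzmax' : ∀ y ∈ C, y ∉ P → up y ≤ up z := fun y hy hyP =>
      hzmax y (Finset.mem_sdiff.2 ⟨hy, hyP⟩)
    by_cases hS : (chain C lo up z).card ≤ m - P.card
    · rw [dif_pos hS]
      refine ih _ ?_ _ (hP.union_chain hlo hzCP.1 hzmax') ?_ ?_ rfl
      · rw [← hn]
        apply Finset.card_lt_card
        rw [Finset.ssubset_iff_of_subset
          (Finset.sdiff_subset_sdiff (Finset.Subset.refl C) Finset.subset_union_left)]
        exact ⟨z, Finset.mem_sdiff.2 hzCP, fun hn => (Finset.mem_sdiff.1 hn).2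
          (Finset.mem_union_right _ (self_mem_chain lo up hzCP.1))⟩
      · exact (Finset.card_union_le _ _).trans ((Nat.add_le_add_left hS _).trans (by omega))
      · intro he x hx
        rcases Finset.mem_union.1 hx with hx | hx
        · obtain ⟨w, hw, hxw, hw0, hwP⟩ := hpos he x hx
          exact ⟨w, hw, hxw, hw0, hwP.trans Finset.subset_union_left⟩
        · exact ⟨z, hzCP.1, hx, hzpos.resolve_left (by simp [he]), Finset.subset_union_right⟩
    · rw [dif_neg hS]
      exact ⟨P, hP, hPm, hpos, Or.inr ⟨z, hzCP.1, hzCP.2, hzmax', not_le.1 hS, h.1, _, rfl⟩⟩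
  · rw [pickLoop, dif_neg h]
    refine ⟨P, hP, hPm, hpos, Or.inl ⟨rfl, ?_⟩⟩
    by_cases hc : P.card = m
    · exact Or.inl hc
    right
    intro y hy hyP
    obtain ⟨x, hx, hxmax⟩ := Finset.exists_max_image (C \ P) up ⟨y, Finset.mem_sdiff.2 ⟨hy, hyP⟩⟩
    have h2 : ¬ (exact = true ∨ 0 < up x) := fun h' => h ⟨lt_of_le_of_ne hPm hc, x, hx, hxmax, h'⟩
    rw [not_or, not_lt, Bool.not_eq_true] at h2
    exact ⟨h2.1, (hxmax y (Finset.mem_sdiff.2 ⟨hy, hyP⟩)).trans h2.2⟩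

theorem pick_cases (m : ℕ) (exact : Bool) (hlo : ∀ x, lo x ≤ up x) :
    ∃ F, IsTop C lo up F ∧ F.card ≤ m ∧ (exact = false → PositiveChains C lo up F) ∧
      ((pick m exact C lo up = PMF.pure F ∧
        (F.card = m ∨ ∀ y ∈ C, y ∉ F → exact = false ∧ up y ≤ 0)) ∨
      ∃ z ∈ C, z ∉ F ∧ (∀ y ∈ C, y ∉ F → up y ≤ up z) ∧ m - F.card < (chain C lo up z).card ∧
        F.card < m ∧
        ∃ hne : ((chain C lo up z).powersetCard (m - F.card)).Nonempty,
        pick m exact C lo up =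
          (PMF.uniformOfFinset ((chain C lo up z).powersetCard (m - F.card)) hne).map
            (fun Q => F ∪ Q)) :=
  pickLoop_cases m exact hlo ∅ isTop_empty (by simp) (fun _ => by simp [PositiveChains])

/-! ### Marginals -/

section Uniform

variable {F S : Finset α} {j : ℕ} (hne : (S.powersetCard j).Nonempty)

theorem marginal_map_eq_one {x : α} (hx : x ∈ F) :
    marginal ((PMF.uniformOfFinset (S.powersetCard j) hne).map (fun Q => F ∪ Q)) x = 1 := by
  rw [marginal, PMF.toOuterMeasure_map_apply, PMF.toOuterMeasure_apply_eq_one_iff]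
  intro Q _
  simp [hx]

theorem marginal_map_eq_zero {x : α} (hxF : x ∉ F) (hxS : x ∉ S) :
    marginal ((PMF.uniformOfFinset (S.powersetCard j) hne).map (fun Q => F ∪ Q)) x = 0 := by
  rw [marginal, PMF.toOuterMeasure_map_apply, PMF.toOuterMeasure_apply_eq_zero_iff,
    Set.disjoint_left]
  intro Q hQ hxQ
  rw [PMF.mem_support_uniformOfFinset_iff, Finset.mem_powersetCard] at hQ
  simp only [Set.mem_preimage, Set.mem_ofPred_eq, Finset.mem_union, hxF, false_or] at hxQ
  exact hxS (hQ.1 hxQ)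

theorem card_filter_mem_powersetCard {x : α} (hxS : x ∈ S) (hj : 0 < j) :
    ((S.powersetCard j).filter (fun Q => x ∈ Q)).card = (S.card - 1).choose (j - 1) := by
  rw [← Finset.card_erase_of_mem hxS, ← Finset.card_powersetCard]
  refine Finset.card_bij (fun Q _ => Q.erase x) ?_ ?_ ?_
  · intro Q hQ
    rw [Finset.mem_filter, Finset.mem_powersetCard] at hQ
    rw [Finset.mem_powersetCard, Finset.card_erase_of_mem hQ.2, hQ.1.2]
    exact ⟨Finset.erase_subset_erase _ hQ.1.1, rfl⟩
  · intro Q hQ Q' hQ' h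
    rw [← Finset.insert_erase (Finset.mem_filter.1 hQ).2, h,
      Finset.insert_erase (Finset.mem_filter.1 hQ').2]
  · intro Q hQ
    rw [Finset.mem_powersetCard] at hQ
    have hxQ : x ∉ Q := fun h => Finset.notMem_erase x S (hQ.1 h)
    refine ⟨insert x Q, ?_, Finset.erase_insert hxQ⟩
    rw [Finset.mem_filter, Finset.mem_powersetCard, Finset.card_insert_of_notMem hxQ, hQ.2]
    refine ⟨⟨Finset.insert_subset hxS (hQ.1.trans (Finset.erase_subset _ _)), ?_⟩,
      Finset.mem_insert_self _ _⟩
    omega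

/-- Counting the `j`-subsets through `x` gives a ratio of binomial coefficients, which equals `j /
|S|` by absorption. -/
theorem marginal_map_of_mem {x : α} (hxF : x ∉ F) (hxS : x ∈ S) (hj : 0 < j) :
    marginal ((PMF.uniformOfFinset (S.powersetCard j) hne).map (fun Q => F ∪ Q)) x =
      ENNReal.ofReal (j / S.card) := by
  classical
  rw [marginal, PMF.toOuterMeasure_map_apply, PMF.toOuterMeasure_uniformOfFinset_apply]
  have h1 : ((S.powersetCard j).filter
      (fun Q => Q ∈ (fun Q => F ∪ Q) ⁻¹' {A : Finset α | x ∈ A})).card =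
      (S.card - 1).choose (j - 1) := by
    rw [← card_filter_mem_powersetCard hxS hj]
    congr 1
    ext Q
    simp [hxF]
  rw [h1, Finset.card_powersetCard]
  obtain ⟨Q, hQ⟩ := hne
  rw [Finset.mem_powersetCard] at hQ
  have hjS : j ≤ S.card := hQ.2 ▸ Finset.card_le_card hQ.1
  have hpos : 0 < S.card.choose j := Nat.choose_pos hjS
  have hmul := Nat.add_one_mul_choose_eq (S.card - 1) (j - 1)
  rw [Nat.sub_add_cancel (hj.trans_le hjS),
    Nat.sub_add_cancel hj] at hmul
  rw [← ENNReal.ofReal_natCast, ← ENNReal.ofReal_natCast,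
    ← ENNReal.ofReal_div_of_pos (by exact_mod_cast hpos)]
  congr 1
  have hS : (0 : ℝ) < S.card := by exact_mod_cast hj.trans_le hjS
  have hpos' : (0 : ℝ) < S.card.choose j := by exact_mod_cast hpos
  rw [div_eq_div_iff hpos'.ne' hS.ne']
  have : (S.card : ℝ) * (S.card - 1).choose (j - 1) = S.card.choose j * j := by exact_mod_cast hmul
  linarith

end Uniform

/-- An arm whose interval reaches up to the interval of another arm is picked with at least the
probability of the other arm. -/
theorem marginal_pick_le (m : ℕ) (exact : Bool) (hlo : ∀ x, lo x ≤ up x) {x x' : α}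
    (hx : x ∈ C) (h : lo x' ≤ up x) :
    marginal (pick m exact C lo up) x' ≤ marginal (pick m exact C lo up) x := by
  -- Top sets are closed upwards. Applied to `F` and to `F` together with the next chain, this
  -- leaves only comparisons among the values `1`, `j / |S|` and `0`.
  have hmono : ∀ G, IsTop C lo up G → x' ∈ G → x ∈ G := fun G hG hx'G => by
    by_contra hxG
    linarith [hG.2 x' hx'G x hx hxG]
  obtain ⟨F, hF, -, -, ⟨h1, -⟩ | ⟨z, hzC, hzF, hz, hcard, hFm, hne, h1⟩⟩ :=
    pick_cases (C := C) m exact hlo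
  · rw [h1]
    by_cases hx' : x' ∈ F
    · rw [marginal_pure_of_mem (hmono F hF hx'), marginal_pure_of_mem hx']
    · simp [marginal_pure_of_not_mem hx']
  · rw [h1]
    have hFS := hF.union_chain hlo hzC hz
    have hdis := hF.disjoint_chain hzF
    have hj : 0 < m - F.card := by omega
    by_cases hx'F : x' ∈ F
    · rw [marginal_map_eq_one hne (hmono F hF hx'F), marginal_map_eq_one hne hx'F]
    by_cases hx'S : x' ∈ chain C lo up z
    · rw [marginal_map_of_mem hne hx'F hx'S hj]
      by_cases hxF : x ∈ F
      · rw [marginal_map_eq_one hne hxF, ENNReal.ofReal_le_one]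
        apply div_le_one_of_le₀ _ (by positivity)
        exact_mod_cast hcard.le
      · have hxS := (Finset.mem_union.1
          (hmono _ hFS (Finset.mem_union_right _ hx'S))).resolve_left hxF
        rw [marginal_map_of_mem hne hxF hxS hj]
    · simp [marginal_map_eq_zero hne hx'F hx'S]

/-! ### Sizes of the picked sets -/

theorem card_le_of_mem_support_pick (m : ℕ) (exact : Bool) (hlo : ∀ x, lo x ≤ up x) {A : Finset α}
    (hA : A ∈ (pick m exact C lo up).support) : A.card ≤ m := by
  obtain ⟨F, hF, hFm, -, ⟨h1, -⟩ | ⟨z, hzC, hzF, hz, hcard, hFm', hne, h1⟩⟩ :=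
    pick_cases (C := C) m exact hlo
  · rw [h1, PMF.support_pure, Set.mem_singleton_iff] at hA
    rwa [hA]
  · rw [h1, PMF.mem_support_map_iff] at hA
    obtain ⟨Q, hQ, rfl⟩ := hA
    rw [PMF.mem_support_uniformOfFinset_iff, Finset.mem_powersetCard] at hQ
    exact (Finset.card_union_le _ _).trans (by omega)

/-! ### The regret of one round -/

/-- Exchange argument: a set `A` that contains all arms above the threshold `θ` and whose
other arms miss the threshold by at most `Δ` is nearly optimal among the sets of its size. -/
theorem sum_le_sum_add_of_threshold {v : α → ℝ} {θ Δ : ℝ} {F Q A : Finset α}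
    (hFQ : Disjoint F Q) (hF : ∀ x ∈ F, θ ≤ v x) (hAF : ∀ x ∈ A, x ∉ F → v x ≤ θ)
    (hQ : ∀ x ∈ Q, θ - Δ ≤ v x) (hcard : A.card = F.card + Q.card) :
    ∑ x ∈ A, v x ≤ ∑ x ∈ F ∪ Q, v x + Q.card * Δ := by
  -- After subtracting the threshold, arms outside `F` contribute at most zero and arms of `F` at
  -- least zero. The equality of cardinalities later cancels the multiples of `θ`.
  have h1 : ∑ x ∈ A, (v x - θ) ≤ ∑ x ∈ F, (v x - θ) := by
    rw [← Finset.sum_filter_add_sum_filter_not A (· ∈ F)]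
    have ha : ∑ x ∈ A with x ∉ F, (v x - θ) ≤ 0 := Finset.sum_nonpos fun x hx => by
      rw [Finset.mem_filter] at hx
      linarith [hAF x hx.1 hx.2]
    have hb : ∑ x ∈ A with x ∈ F, (v x - θ) ≤ ∑ x ∈ F, (v x - θ) :=
      Finset.sum_le_sum_of_subset_of_nonneg (fun x hx => (Finset.mem_filter.1 hx).2)
        fun x hx _ => sub_nonneg.2 (hF x hx)
    linarith
  have h2 : ∑ _x ∈ Q, (θ - Δ) ≤ ∑ x ∈ Q, v x := Finset.sum_le_sum hQ
  rw [Finset.sum_union hFQ]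
  simp only [Finset.sum_sub_distrib, Finset.sum_const, nsmul_eq_mul] at h1 h2
  rw [hcard] at h1
  push_cast at h1
  linarith

/-- Only the randomly filled chain costs anything. The bound involves marginals, not the drawn set,
because the arms whose widths create the error may themselves not be drawn. -/
theorem sum_le_of_mem_support_pick_true {m : ℕ} {v w : α → ℝ}
    (hw : ∀ x, up x - lo x = 2 * w x) (hw0 : ∀ x, 0 ≤ w x) (hv1 : ∀ x ∈ C, |v x| ≤ 1)
    (hv : ∀ x ∈ C, lo x ≤ v x ∧ v x ≤ up x) (hm : m ≤ C.card) {A B : Finset α}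
    (hA : A ∈ (pick m true C lo up).support) (hBC : B ⊆ C) (hB : B.card = m) :
    ∑ x ∈ B, v x ≤ ∑ x ∈ A, v x + 2 * C.card *
      ∑ x ∈ C, (marginal (pick m true C lo up) x).toReal * min 1 (w x) := by
  have hlo : ∀ x, lo x ≤ up x := fun x => by linarith [hw x, hw0 x]
  have hnn : ∀ y, 0 ≤ min 1 (w y) := fun y => le_min zero_le_one (hw0 y)
  have hsum0 : 0 ≤ ∑ x ∈ C, (marginal (pick m true C lo up) x).toReal * min 1 (w x) :=
    Finset.sum_nonneg fun x _ => mul_nonneg ENNReal.toReal_nonneg (hnn x)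
  obtain ⟨F, hF, hFm, -, ⟨h1, h2⟩ | ⟨z, hzC, hzF, hz, hcard, hFm', hne, h1⟩⟩ :=
    pick_cases (C := C) m true hlo
  · rw [h1, PMF.support_pure, Set.mem_singleton_iff] at hA
    subst hA
    suffices h : ∑ x ∈ B, v x ≤ ∑ x ∈ A, v x from h.trans (le_add_of_nonneg_right (by positivity))
    -- In the exact mode the loop can stop early only when no arm is left, and then `m ≤ |C|` still
    -- forces `m` picks.
    have hAm : A.card = m := by
      rcases h2 with h2 | h2
      · exact h2
      · refine le_antisymm hFm (hm.trans (Finset.card_le_card fun y hy => ?_))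
        by_contra hyA
        simpa using (h2 y hy hyA).1
    by_cases hne : ∃ y ∈ C, y ∉ A
    · obtain ⟨y, hy, hyA⟩ := hne
      obtain ⟨z, hz, hzmax⟩ := Finset.exists_max_image (C \ A) up ⟨y, Finset.mem_sdiff.2 ⟨hy, hyA⟩⟩
      rw [Finset.mem_sdiff] at hz
      have := sum_le_sum_add_of_threshold (v := v) (θ := up z) (Δ := 0) (F := A) (Q := ∅) (A := B)
        (by simp) (fun x hx => (hF.2 x hx z hz.1 hz.2).le.trans (hv x (hF.1 hx)).1)
        (fun x hx hxA => (hv x (hBC hx)).2.trans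
          (hzmax x (Finset.mem_sdiff.2 ⟨hBC hx, hxA⟩))) (by simp) (by simp [hB, hAm])
      simpa using this
    · push Not at hne
      have hBA : B ⊆ A := fun x hx => hne x (hBC hx)
      rw [Finset.eq_of_subset_of_card_le hBA (by omega)]
  · have hdis := hF.disjoint_chain hzF
    have hj : 0 < m - F.card := by omega
    set S := chain C lo up z with hS
    -- Every arm of `S` is drawn with probability `(m - |F|) / |S|`. Multiplying by `|S|`, at most
    -- `|C|`, turns the sum over the whole chain into an expected sum over picked arms.
    have hmarg : ((m - F.card : ℕ) : ℝ) * ∑ x ∈ S, min 1 (w x) ≤ C.card *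
        ∑ x ∈ C, (marginal (pick m true C lo up) x).toReal * min 1 (w x) := by
      have hSpos : (0 : ℝ) < S.card := by exact_mod_cast (Nat.zero_le _).trans_lt hcard
      have hSC : (S.card : ℝ) ≤ C.card := by exact_mod_cast Finset.card_le_card (chain_subset z)
      calc ((m - F.card : ℕ) : ℝ) * ∑ x ∈ S, min 1 (w x)
          = S.card * ∑ x ∈ S, (marginal (pick m true C lo up) x).toReal * min 1 (w x) := by
            rw [Finset.mul_sum, Finset.mul_sum]
            refine Finset.sum_congr rfl fun x hx => ?_
            rw [h1, marginal_map_of_mem hne (Finset.disjoint_right.1 hdis hx) hx hj,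
              ENNReal.toReal_ofReal (by positivity)]
            field_simp
        _ ≤ S.card * ∑ x ∈ C, (marginal (pick m true C lo up) x).toReal * min 1 (w x) := by
            gcongr
            · exact fun x _ _ => mul_nonneg ENNReal.toReal_nonneg (hnn x)
            · exact chain_subset z
        _ ≤ _ := by gcongr
    rw [h1, PMF.mem_support_map_iff] at hA
    obtain ⟨Q, hQ, rfl⟩ := hA
    rw [PMF.mem_support_uniformOfFinset_iff, Finset.mem_powersetCard] at hQ
    have := sum_le_sum_add_of_threshold (v := v) (θ := min (up z) 1)
      (Δ := 2 * ∑ y ∈ S, min 1 (w y)) (F := F) (Q := Q) (A := B)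
      (Finset.disjoint_of_subset_right hQ.1 hdis)
      (fun x hx => (min_le_left _ _).trans
        ((hF.2 x hx z hzC hzF).le.trans (hv x (hF.1 hx)).1))
      (fun x hx hxF => le_min ((hv x (hBC hx)).2.trans (hz x (hBC hx) hxF))
        (abs_le.1 (hv1 x (hBC hx))).2)
      (fun x hx => by
        linarith [min_up_one_sub_le hw hw0 hv1 (fun x hx => (hv x hx).1) hzC (hQ.1 hx)])
      (by rw [hB, hQ.2]; omega)
    rw [hQ.2] at this
    linarith

/-- Rejected arms have nonpositive upper bound and cost nothing. A picked arm sits in a fully picked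
chain reaching above zero, so its mean is at least `-2W`, where `W` is the total truncated width of
the picks. -/
theorem sum_le_of_mem_support_pick_false {m : ℕ} {v w : α → ℝ}
    (hw : ∀ x, up x - lo x = 2 * w x) (hw0 : ∀ x, 0 ≤ w x) (hv1 : ∀ x ∈ C, |v x| ≤ 1)
    (hv : ∀ x ∈ C, lo x ≤ v x ∧ v x ≤ up x) (hm : C.card ≤ m) {A B : Finset α}
    (hA : A ∈ (pick m false C lo up).support) (hBC : B ⊆ C) :
    ∑ x ∈ B, v x ≤ ∑ x ∈ A, v x + 2 * C.card * ∑ x ∈ A, min 1 (w x) := by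
  have hlo : ∀ x, lo x ≤ up x := fun x => by linarith [hw x, hw0 x]
  have hnn : ∀ y, 0 ≤ min 1 (w y) := fun y => le_min zero_le_one (hw0 y)
  obtain ⟨F, hF, hFm, hpos, ⟨h1, h2⟩ | ⟨z, hzC, hzF, hz, hcard, hFm', hne, h1⟩⟩ :=
    pick_cases (C := C) m false hlo
  · rw [h1, PMF.support_pure, Set.mem_singleton_iff] at hA
    subst hA
    set W := ∑ x ∈ A, min 1 (w x) with hW
    have hW0 : 0 ≤ W := Finset.sum_nonneg fun x _ => hnn x
    have hlow : ∀ x ∈ A, -v x ≤ 2 * W := by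
      intro x hx
      obtain ⟨z, hzC, hxz, hz0, hzA⟩ := hpos rfl x hx
      have h3 := min_up_one_sub_le hw hw0 hv1 (fun x hx => (hv x hx).1) hzC hxz
      have h4 : ∑ y ∈ chain C lo up z, min 1 (w y) ≤ W :=
        Finset.sum_le_sum_of_subset_of_nonneg hzA fun x _ _ => hnn x
      linarith [lt_min hz0 zero_lt_one]
    have hout : ∀ x ∈ C, x ∉ A → v x ≤ 0 := by
      intro x hx hxA
      rcases h2 with h2 | h2
      · have := Finset.eq_of_subset_of_card_le hF.1 (by omega)
        exact absurd (this ▸ hx) hxA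
      · exact (hv x hx).2.trans (h2 x hx hxA).2
    have hBA : ∑ x ∈ B, v x ≤ ∑ x ∈ A, max (v x) 0 := by
      rw [← Finset.sum_filter_add_sum_filter_not B (· ∈ A)]
      have ha : ∑ x ∈ B with x ∉ A, v x ≤ 0 := Finset.sum_nonpos fun x hx => by
        rw [Finset.mem_filter] at hx
        exact hout x (hBC hx.1) hx.2
      have hb : ∑ x ∈ B with x ∈ A, v x ≤ ∑ x ∈ A, max (v x) 0 :=
        (Finset.sum_le_sum fun x _ => le_max_left _ _).trans
        (Finset.sum_le_sum_of_subset_of_nonneg (fun x hx => (Finset.mem_filter.1 hx).2)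
          fun x _ _ => le_max_right _ _)
      linarith
    have hA2 : ∑ x ∈ A, max (v x) 0 ≤ ∑ x ∈ A, (v x + 2 * W) :=
      Finset.sum_le_sum fun x hx => max_le (by linarith) (by linarith [hlow x hx])
    rw [Finset.sum_add_distrib, Finset.sum_const, nsmul_eq_mul] at hA2
    have hAC : (A.card : ℝ) ≤ C.card := by exact_mod_cast Finset.card_le_card hF.1
    nlinarith
  -- A chain that does not fit would, together with the disjoint set `F`, have more than `m ≥ |C|`
  -- arms inside `C`.
  · exfalso
    have := Finset.card_le_card (Finset.union_subset hF.1 (chain_subset (lo := lo) (up := up) z))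
    rw [Finset.card_union_of_disjoint (hF.disjoint_chain hzF)] at this
    omega

end PickStructure

/-! ### Positive definite matrices -/

section LinearAlgebra

variable {d : ℕ} {V : Matrix (Fin d) (Fin d) ℝ}

/-- Cauchy-Schwarz for a semidefinite form, from the discriminant of the nonnegative quadratic `s ↦
(x + s y)ᵀ V (x + s y)`. -/
theorem sq_dotProduct_mulVec_le (hV : V.PosSemidef) (x y : Fin d → ℝ) :
    (x ⬝ᵥ V *ᵥ y) ^ 2 ≤ (x ⬝ᵥ V *ᵥ x) * (y ⬝ᵥ V *ᵥ y) := by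
  have hsymm : y ⬝ᵥ V *ᵥ x = x ⬝ᵥ V *ᵥ y := by
    rw [dotProduct_mulVec, ← mulVec_transpose, dotProduct_comm]
    congr 2
    simpa using hV.isHermitian.eq
  have h : ∀ s : ℝ, 0 ≤ (y ⬝ᵥ V *ᵥ y) * (s * s) + (2 * (x ⬝ᵥ V *ᵥ y)) * s + x ⬝ᵥ V *ᵥ x := by
    intro s
    have h1 := hV.dotProduct_mulVec_nonneg (x + s • y)
    simp only [star_trivial, mulVec_add, mulVec_smul, dotProduct_add, add_dotProduct,
      dotProduct_smul, smul_dotProduct, smul_eq_mul, hsymm] at h1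
    linarith
  have := discrim_le_zero h
  rw [discrim] at this
  nlinarith

theorem posSemidef_vecMulVec (x : Fin d → ℝ) : (vecMulVec x x).PosSemidef := by
  simpa using posSemidef_vecMulVec_self_star x

theorem posDef_add_sum (hV : V.PosDef) (A : Finset (Fin d → ℝ)) :
    (V + ∑ x ∈ A, vecMulVec x x).PosDef :=
  hV.add_posSemidef (posSemidef_sum _ fun x _ => posSemidef_vecMulVec x)

theorem det_add_vecMulVec (hV : V.PosDef) (x : Fin d → ℝ) :
    (V + vecMulVec x x).det = V.det * (1 + x ⬝ᵥ V⁻¹ *ᵥ x) := by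
  rw [vecMulVec_eq Unit, det_add_replicateCol_mul_replicateRow hV.det_pos.ne'.isUnit,
    Matrix.mul_assoc]
  congr 1
  simp [det_unique, Matrix.mul_apply, replicateRow, replicateCol, dotProduct, mulVec]

theorem dotProduct_inv_mulVec_nonneg (hV : V.PosDef) (x : Fin d → ℝ) : 0 ≤ x ⬝ᵥ V⁻¹ *ᵥ x := by
  simpa using hV.inv.posSemidef.dotProduct_mulVec_nonneg x

theorem det_le_det_add_sum (hV : V.PosDef) (A : Finset (Fin d → ℝ)) :
    V.det ≤ (V + ∑ x ∈ A, vecMulVec x x).det := by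
  classical
  induction A using Finset.induction_on with
  | empty => simp
  | insert a A ha ih =>
    rw [Finset.sum_insert ha, add_comm (vecMulVec a a), ← add_assoc,
      det_add_vecMulVec (posDef_add_sum hV A)]
    refine ih.trans (le_mul_of_one_le_right (posDef_add_sum hV A).det_pos.le ?_)
    linarith [dotProduct_inv_mulVec_nonneg (posDef_add_sum hV A) a]

/-- Within a batch the matrix is not updated, so each arm is compared with the growth of the
determinant over the entire batch. This is the source of the factor `m` in `sum_min_one_le`. -/
theorem det_mul_one_add_le_det_add_sum (hV : V.PosDef) {A : Finset (Fin d → ℝ)} {x : Fin d → ℝ}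
    (hx : x ∈ A) : V.det * (1 + x ⬝ᵥ V⁻¹ *ᵥ x) ≤ (V + ∑ x ∈ A, vecMulVec x x).det := by
  classical
  rw [← Finset.add_sum_erase A _ hx, ← add_assoc, ← det_add_vecMulVec hV]
  exact det_le_det_add_sum (hV.add_posSemidef (posSemidef_vecMulVec x)) _

/-- The inequality of arithmetic and geometric means for the eigenvalues. -/
theorem det_le_trace_div_pow (hd : 0 < d) (hV : V.PosSemidef) : V.det ≤ (V.trace / d) ^ d := by
  have hd' : (0 : ℝ) < d := by exact_mod_cast hd
  have h1 := hV.isHermitian.det_eq_prod_eigenvalues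
  have h2 := hV.isHermitian.trace_eq_sum_eigenvalues
  have h := Real.geom_mean_le_arith_mean Finset.univ (fun _ : Fin d => (1 : ℝ))
    hV.isHermitian.eigenvalues (by simp) (by simpa using hd) (fun i _ => hV.eigenvalues_nonneg i)
  simp only [Real.rpow_one, Finset.sum_const, Finset.card_univ, Fintype.card_fin, nsmul_eq_mul,
    mul_one, one_mul] at h
  have hnn : 0 ≤ ∏ i, hV.isHermitian.eigenvalues i :=
    Finset.prod_nonneg fun i _ => hV.eigenvalues_nonneg i
  have h3 := pow_le_pow_left₀ (by positivity) h d
  rw [← Real.rpow_natCast, ← Real.rpow_mul hnn, inv_mul_cancel₀ hd'.ne', Real.rpow_one] at h3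
  rw [h1, h2]
  simpa using h3

end LinearAlgebra

/-! ### The Gram matrix and the estimator -/

section Gram

variable {d : ℕ} {γ : ℝ} {P : ℕ → Finset (Fin d → ℝ)}

theorem gram_zero : gram γ P 0 = γ • (1 : Matrix (Fin d) (Fin d) ℝ) := by simp [gram]

theorem gram_succ (t : ℕ) : gram γ P (t + 1) = gram γ P t + ∑ x ∈ P t, vecMulVec x x := by
  rw [gram, gram, Finset.sum_range_succ]
  abel

theorem gram_posDef (hγ : 0 < γ) (t : ℕ) : (gram γ P t).PosDef := by
  induction t with
  | zero =>
    rw [gram_zero]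
    exact PosDef.one.smul hγ
  | succ t ih =>
    rw [gram_succ]
    exact posDef_add_sum ih _

theorem width_nonneg (m : ℕ) (γ δ : ℝ) (P : ℕ → Finset (Fin d → ℝ)) (t : ℕ) (x : Fin d → ℝ) :
    0 ≤ width m γ δ P t x :=
  mul_nonneg (Real.sqrt_nonneg _) (add_nonneg (Real.sqrt_nonneg _) (Real.sqrt_nonneg _))

theorem dotProduct_self_le {x : Fin d → ℝ} (hx : ∀ i, |x i| ≤ 1) : x ⬝ᵥ x ≤ d := by
  calc x ⬝ᵥ x ≤ ∑ _i : Fin d, (1 : ℝ) := Finset.sum_le_sum fun i _ => by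
        rw [← abs_mul_abs_self]
        exact mul_le_one₀ (hx i) (abs_nonneg _) (hx i)
    _ = d := by simp

theorem trace_gram (t : ℕ) :
    (gram γ P t).trace = (∑ s ∈ Finset.range t, ∑ x ∈ P s, x ⬝ᵥ x) + γ * d := by
  simp [gram, trace_sum, trace_vecMulVec]

theorem det_gram_le (hd : 0 < d) (hγ : 0 < γ) {m t : ℕ} (hP : ∀ s < t, (P s).card ≤ m)
    (hx : ∀ s < t, ∀ x ∈ P s, ∀ i, |x i| ≤ 1) : (gram γ P t).det ≤ (γ + m * t) ^ d := by
  have hd' : (0 : ℝ) < d := by exact_mod_cast hd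
  have h1 : ∑ s ∈ Finset.range t, ∑ x ∈ P s, x ⬝ᵥ x ≤ t * (m * d) := by
    calc ∑ s ∈ Finset.range t, ∑ x ∈ P s, x ⬝ᵥ x
        ≤ ∑ _s ∈ Finset.range t, (m * d : ℝ) := by
          refine Finset.sum_le_sum fun s hs => ?_
          rw [Finset.mem_range] at hs
          calc ∑ x ∈ P s, x ⬝ᵥ x ≤ ∑ _x ∈ P s, (d : ℝ) :=
                Finset.sum_le_sum fun x hxs => dotProduct_self_le (hx s hs x hxs)
            _ = (P s).card * d := by simp
            _ ≤ m * d := by gcongr; exact hP s hs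
      _ = _ := by simp
  refine (det_le_trace_div_pow hd (gram_posDef hγ t).posSemidef).trans ?_
  rw [trace_gram]
  have h0 : 0 ≤ ∑ s ∈ Finset.range t, ∑ x ∈ P s, x ⬝ᵥ x :=
    Finset.sum_nonneg fun s _ => Finset.sum_nonneg fun x _ => by
      simpa using dotProduct_star_self_nonneg x
  gcongr
  rw [div_le_iff₀ hd']
  nlinarith

theorem log_det_gram_div_le (hd : 0 < d) (hγ : 0 < γ) {m t : ℕ} (hP : ∀ s < t, (P s).card ≤ m)
    (hx : ∀ s < t, ∀ x ∈ P s, ∀ i, |x i| ≤ 1) :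
    Real.log ((gram γ P t).det / γ ^ d) ≤ d * Real.log (1 + m * t / γ) := by
  rw [← Real.log_pow]
  refine Real.log_le_log (div_pos (gram_posDef hγ t).det_pos (by positivity)) ?_
  rw [div_le_iff₀ (by positivity), ← mul_pow]
  refine (det_gram_le hd hγ hP hx).trans_eq ?_
  congr 1
  field_simp

theorem min_one_le_two_mul_log {u : ℝ} (hu : 0 ≤ u) : min 1 u ≤ 2 * Real.log (1 + u) := by
  have hu1 : (0 : ℝ) < 1 + u := by linarith
  rcases le_total 1 u with h | h
  · rw [min_eq_left h]
    have := Real.log_le_log (by norm_num) (show (2 : ℝ) ≤ 1 + u by linarith)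
    linarith [Real.log_two_gt_d9]
  · rw [min_eq_right h]
    have h1 := Real.one_sub_inv_le_log_of_pos hu1
    have h2 : u / 2 ≤ 1 - (1 + u)⁻¹ := by
      rw [← sub_nonneg]
      have : 1 - (1 + u)⁻¹ - u / 2 = u * (1 - u) / (2 * (1 + u)) := by field_simp; ring
      rw [this]
      exact div_nonneg (mul_nonneg hu (by linarith)) (by linarith)
    linarith

/-- The elliptical potential lemma for batches. -/
theorem sum_min_one_le (hγ : 0 < γ) {m : ℕ} (T : ℕ) (hP : ∀ s < T, (P s).card ≤ m) :
    ∑ t ∈ Finset.range T, ∑ x ∈ P t, min 1 (x ⬝ᵥ (gram γ P t)⁻¹ *ᵥ x) ≤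
      2 * m * Real.log ((gram γ P T).det / γ ^ d) := by
  induction T with
  | zero =>
    simp [gram_zero, hγ.ne']
  | succ T ih =>
    rw [Finset.sum_range_succ]
    have ih := ih fun s hs => hP s (hs.trans (Nat.lt_succ_self T))
    have hV := gram_posDef (P := P) hγ T
    have hV' := gram_posDef (P := P) hγ (T + 1)
    have hstep : ∑ x ∈ P T, min 1 (x ⬝ᵥ (gram γ P T)⁻¹ *ᵥ x) ≤
        2 * m * (Real.log (gram γ P (T + 1)).det - Real.log (gram γ P T).det) := by
      have hx : ∀ x ∈ P T, min 1 (x ⬝ᵥ (gram γ P T)⁻¹ *ᵥ x) ≤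
          2 * (Real.log (gram γ P (T + 1)).det - Real.log (gram γ P T).det) := by
        intro x hx
        have h0 := dotProduct_inv_mulVec_nonneg hV x
        have h1 := det_mul_one_add_le_det_add_sum hV hx
        rw [← gram_succ] at h1
        have h2 := Real.log_le_log (mul_pos hV.det_pos (by linarith)) h1
        rw [Real.log_mul hV.det_pos.ne' (by linarith)] at h2
        linarith [min_one_le_two_mul_log h0]
      have hnn : 0 ≤ Real.log (gram γ P (T + 1)).det - Real.log (gram γ P T).det := by
        rw [sub_nonneg, gram_succ]
        exact Real.log_le_log hV.det_pos (det_le_det_add_sum hV _)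
      have hc : ((P T).card : ℝ) ≤ m := by exact_mod_cast hP T (Nat.lt_succ_self T)
      have := Finset.sum_le_sum hx
      rw [Finset.sum_const, nsmul_eq_mul] at this
      nlinarith
    rw [Real.log_div hV.det_pos.ne' (by positivity)] at ih
    rw [Real.log_div hV'.det_pos.ne' (by positivity)]
    nlinarith

/-- The noise vector of the rounds before `t`, shifted by the regularization bias. -/
def residual (γ : ℝ) (β : Fin d → ℝ) (P : ℕ → Finset (Fin d → ℝ)) (y : ℕ → (Fin d → ℝ) → ℝ)
    (t : ℕ) : Fin d → ℝ :=
  (∑ s ∈ Finset.range t, ∑ x ∈ P s, (y s x - β ⬝ᵥ x) • x) - γ • β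

/-- Regularization contributes the term `-γ β` to the normal equations; absorbing it into `residual`
makes the error exactly linear in one vector. -/
theorem ridge_sub (hγ : 0 < γ) (β : Fin d → ℝ) (y : ℕ → (Fin d → ℝ) → ℝ) (t : ℕ) :
    ridge γ P y t - β = (gram γ P t)⁻¹ *ᵥ residual γ β P y t := by
  have hunit : IsUnit (gram γ P t).det := (gram_posDef hγ t).det_pos.ne'.isUnit
  have h1 : gram γ P t *ᵥ β =
      (∑ s ∈ Finset.range t, ∑ x ∈ P s, (β ⬝ᵥ x) • x) + γ • β := by
    simp only [gram, add_mulVec, sum_mulVec, smul_mulVec, one_mulVec]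
    congr 1
    refine Finset.sum_congr rfl fun s _ => Finset.sum_congr rfl fun x _ => ?_
    ext i
    simp only [mulVec, vecMulVec, dotProduct, of_apply, Pi.smul_apply, smul_eq_mul, Finset.sum_mul]
    exact Finset.sum_congr rfl fun j _ => by ring
  have h2 : β = (gram γ P t)⁻¹ *ᵥ (gram γ P t *ᵥ β) := by
    rw [mulVec_mulVec, nonsing_inv_mul _ hunit, one_mulVec]
  rw [ridge]
  conv_lhs => rw [h2]
  rw [← mulVec_sub, h1, residual]
  congr 1
  simp only [sub_smul, Finset.sum_sub_distrib]
  abel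

theorem abs_ridge_sub_le (hγ : 0 < γ) (β : Fin d → ℝ) (y : ℕ → (Fin d → ℝ) → ℝ) (t : ℕ)
    (x : Fin d → ℝ) :
    |ridge γ P y t ⬝ᵥ x - β ⬝ᵥ x| ≤ √(x ⬝ᵥ (gram γ P t)⁻¹ *ᵥ x) *
      √(residual γ β P y t ⬝ᵥ (gram γ P t)⁻¹ *ᵥ residual γ β P y t) := by
  have hV := gram_posDef (P := P) hγ t
  rw [← sub_dotProduct, ridge_sub hγ, dotProduct_comm,
    ← Real.sqrt_mul (dotProduct_inv_mulVec_nonneg hV x)]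
  exact Real.abs_le_sqrt (sq_dotProduct_mulVec_le hV.inv.posSemidef x _)

end Gram

/-! ### A Gaussian integral -/

section Gaussian

variable {d : ℕ}

/-- The total mass of the unnormalized standard Gaussian on `Fin d → ℝ`. -/
def gaussianMass (d : ℕ) : ENNReal :=
  ∫⁻ u : Fin d → ℝ, ENNReal.ofReal (Real.exp (-(u ⬝ᵥ u) / 2))

/-- The exact mass is irrelevant: it cancels between the mixture and its initial value, so
finiteness and positivity suffice. -/
theorem gaussianMass_ne_top : gaussianMass d ≠ ⊤ := by
  have h : Integrable (fun u : Fin d → ℝ => ∏ i, Real.exp (-(1 / 2) * u i ^ 2)) :=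
    Integrable.fintype_prod (f := fun _ u => Real.exp (-(1 / 2) * u ^ 2))
      fun _ => integrable_exp_neg_mul_sq (by norm_num)
  have h2 := h.lintegral_lt_top
  convert h2.ne using 1
  refine lintegral_congr fun u => ?_
  rw [← Real.exp_sum]
  congr 2
  rw [dotProduct, ← Finset.mul_sum]
  simp only [sq]
  ring

theorem gaussianMass_ne_zero : gaussianMass d ≠ 0 := by
  rw [gaussianMass, Ne, lintegral_eq_zero_iff (by unfold dotProduct; fun_prop)]
  intro h
  obtain ⟨u, hu⟩ := h.exists
  simp only [Pi.zero_apply, ENNReal.ofReal_eq_zero] at hu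
  exact absurd (Real.exp_pos _) (not_lt.2 hu)

open scoped MatrixOrder in
-- Complete the square at `V⁻¹ b`, factor `V = BᵀB`, and substitute `B u`; the Jacobian is `|det B|
-- = √(det V)`.
theorem lintegral_exp_quadratic {V : Matrix (Fin d) (Fin d) ℝ} (hV : V.PosDef) (b : Fin d → ℝ) :
    ∫⁻ u : Fin d → ℝ, ENNReal.ofReal (Real.exp (u ⬝ᵥ b - (u ⬝ᵥ V *ᵥ u) / 2)) =
      ENNReal.ofReal (Real.exp ((b ⬝ᵥ V⁻¹ *ᵥ b) / 2) / √V.det) * gaussianMass d := by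
  obtain ⟨B, hB⟩ := CStarAlgebra.nonneg_iff_eq_star_mul_self.mp hV.posSemidef.nonneg
  rw [star_eq_conjTranspose, conjTranspose_eq_transpose_of_trivial] at hB
  have hdet : V.det = B.det ^ 2 := by rw [hB, det_mul, det_transpose, sq]
  have hB0 : B.det ≠ 0 := fun h => hV.det_pos.ne' (by rw [hdet, h]; simp)
  have hVsymm : Vᵀ = V := by simpa using hV.isHermitian.eq
  set c := V⁻¹ *ᵥ b with hc
  have hVc : V *ᵥ c = b := by
    rw [hc, mulVec_mulVec, mul_nonsing_inv _ hV.det_pos.ne'.isUnit, one_mulVec]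
  have hquad : ∀ u : Fin d → ℝ, u ⬝ᵥ V *ᵥ u = (B *ᵥ u) ⬝ᵥ (B *ᵥ u) := fun u => by
    rw [hB, ← mulVec_mulVec, dotProduct_mulVec, vecMul_transpose]
  have hsq : ∀ u : Fin d → ℝ, u ⬝ᵥ b - (u ⬝ᵥ V *ᵥ u) / 2 =
      (b ⬝ᵥ c) / 2 + -((B *ᵥ (u - c)) ⬝ᵥ (B *ᵥ (u - c))) / 2 := by
    intro u
    rw [← hquad]
    have hcu : c ⬝ᵥ V *ᵥ u = u ⬝ᵥ b := by
      rw [dotProduct_mulVec, ← mulVec_transpose, hVsymm, hVc, dotProduct_comm]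
    simp only [mulVec_sub, sub_dotProduct, dotProduct_sub, hcu, hVc, dotProduct_comm c b]
    ring
  have hmap := Real.map_matrix_volume_pi_eq_smul_volume_pi hB0
  calc ∫⁻ u : Fin d → ℝ, ENNReal.ofReal (Real.exp (u ⬝ᵥ b - (u ⬝ᵥ V *ᵥ u) / 2))
      = ∫⁻ u : Fin d → ℝ, ENNReal.ofReal (Real.exp ((b ⬝ᵥ c) / 2)) *
          ENNReal.ofReal (Real.exp (-((B *ᵥ (u - c)) ⬝ᵥ (B *ᵥ (u - c))) / 2)) := by
        refine lintegral_congr fun u => ?_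
        rw [hsq, Real.exp_add, ENNReal.ofReal_mul (Real.exp_pos _).le]
    _ = ENNReal.ofReal (Real.exp ((b ⬝ᵥ c) / 2)) * ∫⁻ u : Fin d → ℝ,
          ENNReal.ofReal (Real.exp (-((B *ᵥ (u - c)) ⬝ᵥ (B *ᵥ (u - c))) / 2)) :=
        lintegral_const_mul' _ _ ENNReal.ofReal_ne_top
    _ = ENNReal.ofReal (Real.exp ((b ⬝ᵥ c) / 2)) * ∫⁻ u : Fin d → ℝ,
          ENNReal.ofReal (Real.exp (-((B *ᵥ u) ⬝ᵥ (B *ᵥ u)) / 2)) := by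
        rw [lintegral_sub_right_eq_self
          (fun u => ENNReal.ofReal (Real.exp (-((B *ᵥ u) ⬝ᵥ (B *ᵥ u)) / 2))) c]
    _ = ENNReal.ofReal (Real.exp ((b ⬝ᵥ c) / 2)) *
          (ENNReal.ofReal |B.det⁻¹| * gaussianMass d) := by
        congr 1
        rw [gaussianMass, ← smul_eq_mul, ← lintegral_smul_measure, ← hmap, lintegral_map]
        · rfl
        · unfold dotProduct
          fun_prop
        · exact (LinearMap.continuous_of_finiteDimensional _).measurable
    _ = _ := by
        rw [← mul_assoc, ← ENNReal.ofReal_mul (Real.exp_pos _).le, hdet, Real.sqrt_sq_eq_abs,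
          abs_inv, ← div_eq_mul_inv]

end Gaussian

/-! ### A maximal inequality -/

section Maximal

variable {Ω : Type*} {m0 : MeasurableSpace Ω} {μ : Measure Ω}

/-- **Ville's inequality** for a nonnegative supermartingale. -/
theorem mul_measure_exists_le_lintegral {ℱ : ℕ → MeasurableSpace Ω} {T : ℕ}
    (hmono : ∀ s t, s ≤ t → ℱ s ≤ ℱ t) (hle : ∀ t < T, ℱ t ≤ m0) {N : ℕ → Ω → ENNReal}
    (hN : ∀ t < T, Measurable[ℱ t] (N t))
    (hstep : ∀ t < T, ∀ G, MeasurableSet[ℱ t] G → ∫⁻ ω in G, N (t + 1) ω ∂μ ≤ ∫⁻ ω in G, N t ω ∂μ)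
    (c : ENNReal) : c * μ {ω | ∃ t < T, c ≤ N t ω} ≤ ∫⁻ ω, N 0 ω ∂μ := by
  -- This is the expectation of the process stopped at its first crossing of `c`, with the value at
  -- crossing replaced by the lower bound `c`. In each step the newly crossing event is paid by
  -- Markov's inequality.
  have key : ∀ t ≤ T, ∫⁻ ω in {ω | ∀ s < t, N s ω < c}, N t ω ∂μ + c * μ {ω | ∃ s < t, c ≤ N s ω} ≤
      ∫⁻ ω, N 0 ω ∂μ := by
    intro t ht
    induction t with
    | zero => simp
    | succ t ih =>
      have htT : t < T := ht
      refine le_trans ?_ (ih htT.le)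
      have hG : MeasurableSet[ℱ t] {ω | ∀ s < t, N s ω < c} := by
        have : {ω | ∀ s < t, N s ω < c} = ⋂ s ∈ Finset.range t, {ω | N s ω < c} := by
          ext ω
          simp
        rw [this]
        refine Finset.measurableSet_biInter _ fun s hs => ?_
        rw [Finset.mem_range] at hs
        exact hmono s t hs.le _ (measurableSet_lt (hN s (hs.trans htT)) measurable_const)
      have hB : MeasurableSet[ℱ t] {ω | N t ω < c} := measurableSet_lt (hN t htT) measurable_const
      have hsplit : {ω | ∀ s < t + 1, N s ω < c} = {ω | ∀ s < t, N s ω < c} ∩ {ω | N t ω < c} := by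
        ext ω
        simp only [Set.mem_inter_iff, Set.mem_ofPred_eq, Nat.lt_succ_iff_lt_or_eq, or_imp,
          forall_and, forall_eq]
      have hsub : {ω | ∃ s < t + 1, c ≤ N s ω} ⊆ {ω | ∃ s < t, c ≤ N s ω} ∪
          ({ω | ∀ s < t, N s ω < c} ∩ {ω | N t ω < c}ᶜ) := by
        rintro ω ⟨s, hs, hsc⟩
        by_cases h : ∃ s < t, c ≤ N s ω
        · exact Or.inl h
        · right
          push Not at h
          refine ⟨h, ?_⟩
          rcases Nat.lt_succ_iff_lt_or_eq.1 hs with hs | rfl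
          · exact absurd (h s hs) (not_lt.2 hsc)
          · simpa using hsc
      have hmarkov : c * μ ({ω | ∀ s < t, N s ω < c} ∩ {ω | N t ω < c}ᶜ) ≤
          ∫⁻ ω in {ω | ∀ s < t, N s ω < c} ∩ {ω | N t ω < c}ᶜ, N t ω ∂μ := by
        rw [← setLIntegral_const]
        refine setLIntegral_mono' ((hle t htT _ hG).inter (hle t htT _ hB).compl) fun ω hω => ?_
        simpa using hω.2
      calc _ ≤ ∫⁻ ω in {ω | ∀ s < t, N s ω < c} ∩ {ω | N t ω < c}, N t ω ∂μ +
            (c * μ {ω | ∃ s < t, c ≤ N s ω} +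
              ∫⁻ ω in {ω | ∀ s < t, N s ω < c} ∩ {ω | N t ω < c}ᶜ, N t ω ∂μ) := by
            rw [hsplit]
            refine add_le_add (hstep t htT _ (MeasurableSet.inter hG hB)) ?_
            · refine (mul_le_mul_right (measure_mono hsub) c).trans ?_
              refine (mul_le_mul_right (measure_union_le _ _) c).trans ?_
              rw [mul_add]
              gcongr
        _ = ∫⁻ ω in {ω | ∀ s < t, N s ω < c}, N t ω ∂μ + c * μ {ω | ∃ s < t, c ≤ N s ω} := by
            rw [← lintegral_inter_add_sdiff _ {ω | ∀ s < t, N s ω < c} (hle t htT _ hB),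
              Set.sdiff_eq]
            ring
  exact le_trans le_add_self (key T le_rfl)

end Maximal

/-! ### The observations -/

section Observations

variable {d : ℕ} {Ω : Type*}

section History

variable {C : ℕ → Finset (Fin d → ℝ)} {P : ℕ → Ω → Finset (Fin d → ℝ)}
  {Y : ℕ → (Fin d → ℝ) → Ω → ℝ}

theorem history_mono (s t : ℕ) (hst : s ≤ t) : history C P Y s ≤ history C P Y t :=
  biSup_mono fun r hr => by
    rw [Finset.mem_range] at *
    omega

theorem measurable_pick_history {s t : ℕ} (hst : s < t) :
    Measurable[history C P Y t, ⊤] (P s) := by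
  rw [measurable_iff_comap_le]
  exact le_sup_left.trans (le_biSup (fun s => MeasurableSpace.comap (P s) ⊤ ⊔
    ⨆ x ∈ C s, MeasurableSpace.comap (fun ω => if x ∈ P s ω then Y s x ω else 0) inferInstance)
    (Finset.mem_range.2 hst))

theorem measurable_reward_history {s t : ℕ} (hst : s < t) {x : Fin d → ℝ} (hx : x ∈ C s) :
    Measurable[history C P Y t] (fun ω => if x ∈ P s ω then Y s x ω else 0) := by
  rw [measurable_iff_comap_le]
  refine le_trans ?_ (le_biSup (fun s => MeasurableSpace.comap (P s) ⊤ ⊔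
    ⨆ x ∈ C s, MeasurableSpace.comap (fun ω => if x ∈ P s ω then Y s x ω else 0) inferInstance)
    (Finset.mem_range.2 hst))
  exact le_trans (le_biSup (fun x => MeasurableSpace.comap
    (fun ω => if x ∈ P s ω then Y s x ω else 0) inferInstance) hx) le_sup_right

end History

/-- The logarithm of the likelihood ratio of the observations before round `t` for the direction
`u`, together with the logarithm of a Gaussian weight centered at `-β`. -/
def logWeight (γ : ℝ) (β : Fin d → ℝ) (P : ℕ → Finset (Fin d → ℝ)) (y : ℕ → (Fin d → ℝ) → ℝ)
    (t : ℕ) (u : Fin d → ℝ) : ℝ :=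
  ∑ s ∈ Finset.range t, ∑ x ∈ P s, ((u ⬝ᵥ x) * (y s x - β ⬝ᵥ x) - (u ⬝ᵥ x) ^ 2 / 2) -
    γ / 2 * ((u + β) ⬝ᵥ (u + β))

theorem logWeight_eq (γ : ℝ) (β : Fin d → ℝ) (P : ℕ → Finset (Fin d → ℝ))
    (y : ℕ → (Fin d → ℝ) → ℝ) (t : ℕ) (u : Fin d → ℝ) :
    logWeight γ β P y t u = (u ⬝ᵥ residual γ β P y t - (u ⬝ᵥ gram γ P t *ᵥ u) / 2) +
      -(γ / 2 * (β ⬝ᵥ β)) := by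
  have h1 : u ⬝ᵥ residual γ β P y t =
      ∑ s ∈ Finset.range t, ∑ x ∈ P s, (u ⬝ᵥ x) * (y s x - β ⬝ᵥ x) - γ * (u ⬝ᵥ β) := by
    simp only [residual, dotProduct_sub, dotProduct_sum, dotProduct_smul, smul_eq_mul]
    congr 1
    exact Finset.sum_congr rfl fun s _ => Finset.sum_congr rfl fun x _ => mul_comm _ _
  have h2 : u ⬝ᵥ gram γ P t *ᵥ u =
      ∑ s ∈ Finset.range t, ∑ x ∈ P s, (u ⬝ᵥ x) ^ 2 + γ * (u ⬝ᵥ u) := by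
    simp only [gram, add_mulVec, sum_mulVec, smul_mulVec, one_mulVec, dotProduct_add,
      dotProduct_sum, dotProduct_smul, smul_eq_mul]
    congr 1
    refine Finset.sum_congr rfl fun s _ => Finset.sum_congr rfl fun x _ => ?_
    rw [vecMulVec_mulVec]
    simp [sq, dotProduct_comm]
  rw [h1, h2, logWeight]
  simp only [Finset.sum_sub_distrib, ← Finset.sum_div, add_dotProduct, dotProduct_add,
    dotProduct_comm β u]
  ring

theorem lintegral_exp_logWeight {γ : ℝ} (hγ : 0 < γ) (β : Fin d → ℝ) (P : ℕ → Finset (Fin d → ℝ))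
    (y : ℕ → (Fin d → ℝ) → ℝ) (t : ℕ) :
    ∫⁻ u : Fin d → ℝ, ENNReal.ofReal (Real.exp (logWeight γ β P y t u)) =
      ENNReal.ofReal (Real.exp ((residual γ β P y t ⬝ᵥ (gram γ P t)⁻¹ *ᵥ residual γ β P y t) / 2 -
        γ / 2 * (β ⬝ᵥ β)) / √(gram γ P t).det) * gaussianMass d := by
  simp only [logWeight_eq, Real.exp_add, ENNReal.ofReal_mul (Real.exp_pos _).le]
  rw [lintegral_mul_const' _ _ ENNReal.ofReal_ne_top, lintegral_exp_quadratic (gram_posDef hγ t),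
    mul_right_comm, ← ENNReal.ofReal_mul (by positivity), sub_eq_add_neg, Real.exp_add]
  congr 2
  ring

/-- The random index set `P s` is replaced by the fixed set `C s` with unobserved rewards set to
zero, the form in which the history sees them. The σ-algebra is left general, so that the result
serves both the history and the ambient space. -/
theorem measurable_logWeight [MeasurableSpace Ω] (γ : ℝ) (β : Fin d → ℝ)
    {C : ℕ → Finset (Fin d → ℝ)} {P : ℕ → Ω → Finset (Fin d → ℝ)}
    {Y : ℕ → (Fin d → ℝ) → Ω → ℝ} {t : ℕ} (hPC : ∀ s < t, ∀ ω, P s ω ⊆ C s)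
    (hP : ∀ s < t, Measurable[_, ⊤] (P s))
    (hY : ∀ s < t, ∀ x ∈ C s, Measurable (fun ω => if x ∈ P s ω then Y s x ω else 0)) :
    Measurable (fun p : Ω × (Fin d → ℝ) =>
      logWeight γ β (fun s => P s p.1) (fun s x => Y s x p.1) t p.2) := by
  have hdot : ∀ x : Fin d → ℝ, Measurable (fun p : Ω × (Fin d → ℝ) => p.2 ⬝ᵥ x) := fun x => by
    unfold dotProduct
    fun_prop
  have heq : ∀ p : Ω × (Fin d → ℝ),
      logWeight γ β (fun s => P s p.1) (fun s x => Y s x p.1) t p.2 =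
      ∑ s ∈ Finset.range t, ∑ x ∈ C s, ((p.2 ⬝ᵥ x) * (if x ∈ P s p.1 then Y s x p.1 else 0) +
        if x ∈ P s p.1 then - ((p.2 ⬝ᵥ x) * (β ⬝ᵥ x)) - (p.2 ⬝ᵥ x) ^ 2 / 2 else 0) -
      γ / 2 * ((p.2 + β) ⬝ᵥ (p.2 + β)) := by
    intro p
    rw [logWeight]
    congr 1
    refine Finset.sum_congr rfl fun s hs => ?_
    rw [← Finset.sum_subset (hPC s (Finset.mem_range.1 hs) p.1)]
    · refine Finset.sum_congr rfl fun x hx => ?_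
      rw [if_pos hx, if_pos hx]
      ring
    · intro x _ hx
      simp [hx]
  simp only [heq]
  refine Measurable.sub (Finset.measurable_sum _ fun s hs => Finset.measurable_sum _ fun x hx => ?_)
    (by unfold dotProduct; fun_prop)
  rw [Finset.mem_range] at hs
  refine Measurable.add ((hdot x).mul ((hY s hs x hx).comp measurable_fst)) ?_
  refine Measurable.ite ?_ (by have := hdot x; fun_prop) measurable_const
  exact measurable_fst ((hP s hs) (show MeasurableSet[⊤] {A | x ∈ A} from trivial))

end Observations

/-! ### The supermartingale property -/

section Supermartingale

variable {d : ℕ} {Ω : Type*} [m0 : MeasurableSpace Ω] {μ : Measure Ω}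

/-- Hoeffding's lemma for rewards in `[-1, 1]`. -/
theorem lintegral_exp_noise_le_one [IsProbabilityMeasure μ] {X : Ω → ℝ} (hX : Measurable X)
    (hb : ∀ᵐ ω ∂μ, X ω ∈ Set.Icc (-1 : ℝ) 1) (r : ℝ) :
    ∫⁻ ω, ENNReal.ofReal (Real.exp (r * (X ω - ∫ ω, X ω ∂μ) - r ^ 2 / 2)) ∂μ ≤ 1 := by
  have h := hasSubgaussianMGF_of_mem_Icc hX.aemeasurable hb
  have h1 := h.mgf_le r
  have hint := h.integrable_exp_mul r
  -- The variance proxy is the square of half the length of `[-1,1]`.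
  have hc : (((‖(1 : ℝ) - -1‖₊ / 2) ^ 2 : NNReal) : ℝ) = 1 := by norm_num
  rw [hc, one_mul, mgf] at h1
  have h2 := hint.const_mul (Real.exp (-(r ^ 2 / 2)))
  have heq : ∀ ω, Real.exp (r * (X ω - ∫ ω, X ω ∂μ) - r ^ 2 / 2) =
      Real.exp (-(r ^ 2 / 2)) * Real.exp (r * (X ω - ∫ ω, X ω ∂μ)) := fun ω => by
    rw [← Real.exp_add]
    ring_nf
  simp only [heq]
  rw [← ofReal_integral_eq_lintegral_ofReal h2 (ae_of_all _ fun ω => by positivity),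
    integral_const_mul, ENNReal.ofReal_le_one]
  calc _ ≤ Real.exp (-(r ^ 2 / 2)) * Real.exp (r ^ 2 / 2) := by gcongr
    _ = 1 := by rw [← Real.exp_add]; simp

variable {π : Policy d} {β : Fin d → ℝ} {T : ℕ} {C : ℕ → Finset (Fin d → ℝ)}
  {P : ℕ → Ω → Finset (Fin d → ℝ)} {Y : ℕ → (Fin d → ℝ) → Ω → ℝ}

theorem IsInteraction.measurable_pick (h : IsInteraction π β T C μ P Y) {t : ℕ} (ht : t < T) :
    Measurable[m0, ⊤] (P t) := by
  classical
  intro U _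
  have : P t ⁻¹' U = ⋃ A ∈ {A ∈ (C t).powerset | A ∈ U}, {ω | P t ω = A} := by
    ext ω
    simp [h.pick_subset t ht ω]
  rw [this]
  exact Finset.measurableSet_biUnion _ fun A _ => h.pick_measurable t ht A

theorem IsInteraction.measurable_reward (h : IsInteraction π β T C μ P Y) {t : ℕ} (ht : t < T)
    {x : Fin d → ℝ} (hx : x ∈ C t) : Measurable (fun ω => if x ∈ P t ω then Y t x ω else 0) :=
  Measurable.ite (h.measurable_pick ht (show MeasurableSet[⊤] {A | x ∈ A} from trivial))
    (h.reward_measurable t ht x hx) measurable_const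

theorem IsInteraction.history_le (h : IsInteraction π β T C μ P Y) {t : ℕ} (ht : t ≤ T) :
    history C P Y t ≤ m0 := by
  refine iSup₂_le fun s hs => ?_
  have hsT := (Finset.mem_range.1 hs).trans_le ht
  exact sup_le (measurable_iff_comap_le.1 (h.measurable_pick hsT))
    (iSup₂_le fun x hx => measurable_iff_comap_le.1 (h.measurable_reward hsT hx))

theorem IsInteraction.measurable_exp_logWeight_history (h : IsInteraction π β T C μ P Y) (γ : ℝ)
    {t : ℕ} (ht : t ≤ T) :
    @Measurable _ _ (@Prod.instMeasurableSpace _ _ (history C P Y t) _) _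
      (fun p : Ω × (Fin d → ℝ) => ENNReal.ofReal (Real.exp
        (logWeight γ β (fun s => P s p.1) (fun s x => Y s x p.1) t p.2))) := by
  have hsub : ∀ s < t, ∀ ω, P s ω ⊆ C s := fun s hs => h.pick_subset s (hs.trans_le ht)
  let _ := history C P Y t
  exact ENNReal.measurable_ofReal.comp (Real.measurable_exp.comp
    (measurable_logWeight γ β hsub
      (fun _ hs => measurable_pick_history hs) (fun _ hs _ hx => measurable_reward_history hs hx)))

theorem IsInteraction.measurable_exp_logWeight (h : IsInteraction π β T C μ P Y) (γ : ℝ)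
    {t : ℕ} (ht : t ≤ T) :
    Measurable (fun p : Ω × (Fin d → ℝ) => ENNReal.ofReal (Real.exp
        (logWeight γ β (fun s => P s p.1) (fun s x => Y s x p.1) t p.2))) :=
  ENNReal.measurable_ofReal.comp (Real.measurable_exp.comp
    (measurable_logWeight γ β (fun s hs => h.pick_subset s (hs.trans_le ht))
      (fun _ hs => h.measurable_pick (hs.trans_le ht))
      (fun _ hs _ hx => h.measurable_reward (hs.trans_le ht) hx)))

theorem IsInteraction.measurable_exp_logWeight_left (h : IsInteraction π β T C μ P Y) (γ : ℝ)
    {t : ℕ} (ht : t ≤ T) (u : Fin d → ℝ) :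
    Measurable[history C P Y t] (fun ω => ENNReal.ofReal (Real.exp
        (logWeight γ β (fun s => P s ω) (fun s x => Y s x ω) t u))) := by
  have hm := h.measurable_exp_logWeight_history γ ht
  have hp := @measurable_prodMk_right _ _ (history C P Y t) MeasurableSpace.pi u
  have hmp := hm.comp hp
  exact hmp

variable [IsProbabilityMeasure μ]

theorem IsInteraction.lintegral_prod_exp_le_one (h : IsInteraction π β T C μ P Y) {t : ℕ}
    (ht : t < T) {A : Finset (Fin d → ℝ)} (hA : A ⊆ C t) (u : Fin d → ℝ) :
    ∫⁻ ω, ∏ x ∈ A, ENNReal.ofReal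
      (Real.exp ((u ⬝ᵥ x) * (Y t x ω - β ⬝ᵥ x) - (u ⬝ᵥ x) ^ 2 / 2)) ∂μ ≤ 1 := by
  set f : (Fin d → ℝ) → ℝ → ENNReal := fun x y => ENNReal.ofReal
      (Real.exp ((u ⬝ᵥ x) * (y - β ⬝ᵥ x) - (u ⬝ᵥ x) ^ 2 / 2)) with hf
  have hfm : ∀ x, Measurable (f x) := fun x => by
    simp only [hf]
    fun_prop
  have hind := (h.reward_indep t ht).comp (fun x : C t => f x) (fun x => hfm x)
  have hprod : ∀ ω, ∏ x ∈ A, f x (Y t x ω) =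
      ∏ x ∈ (C t).attach with x.1 ∈ A, f x (Y t x ω) := fun ω => by
    refine (Finset.prod_bij (fun x _ => x.1) (fun x hx => (Finset.mem_filter.1 hx).2)
      (fun x _ y _ hxy => Subtype.ext hxy) (fun x hx => ⟨⟨x, hA hx⟩, ?_, rfl⟩)
      (fun x _ => rfl)).symm
    simp [hx]
  have h2 := lintegral_prod_eq_prod_lintegral_of_indepFun {x ∈ (C t).attach | x.1 ∈ A} _ hind
    (fun x => (hfm x).comp (h.reward_measurable t ht x x.2))
  simp only [Function.comp_apply] at h2
  change ∫⁻ ω, ∏ x ∈ A, f x (Y t x ω) ∂μ ≤ 1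
  simp only [hprod, h2]
  refine Finset.prod_le_one' fun x _ => ?_
  have h3 := lintegral_exp_noise_le_one (μ := μ) (h.reward_measurable t ht x x.2)
    (h.reward_mem t ht x x.2) (u ⬝ᵥ x.1)
  rwa [h.reward_mean t ht x x.2] at h3

/-- Split by the picked set. On `P t = A` the new factor is a function of the current rewards alone,
hence independent of the past and of the pick, and its mean is at most `1`. -/
theorem IsInteraction.setLIntegral_exp_logWeight_succ_le (h : IsInteraction π β T C μ P Y) (γ : ℝ)
    {t : ℕ} (ht : t < T) {G : Set Ω} (hG : MeasurableSet[history C P Y t] G) (u : Fin d → ℝ) :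
    ∫⁻ ω in G, ENNReal.ofReal (Real.exp
      (logWeight γ β (fun s => P s ω) (fun s x => Y s x ω) (t + 1) u)) ∂μ ≤
    ∫⁻ ω in G, ENNReal.ofReal (Real.exp
      (logWeight γ β (fun s => P s ω) (fun s x => Y s x ω) t u)) ∂μ := by
  set W : ℕ → Ω → ENNReal := fun t ω => ENNReal.ofReal (Real.exp
      (logWeight γ β (fun s => P s ω) (fun s x => Y s x ω) t u)) with hW
  set g : Finset (Fin d → ℝ) → Ω → ENNReal := fun A ω => ∏ x ∈ A, ENNReal.ofReal
      (Real.exp ((u ⬝ᵥ x) * (Y t x ω - β ⬝ᵥ x) - (u ⬝ᵥ x) ^ 2 / 2)) with hg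
  have hsucc : ∀ ω, W (t + 1) ω = W t ω * g (P t ω) ω := by
    intro ω
    simp only [hW, hg]
    rw [← ENNReal.ofReal_prod_of_nonneg (fun x _ => (Real.exp_pos _).le), ← Real.exp_sum,
      ← ENNReal.ofReal_mul (Real.exp_pos _).le, ← Real.exp_add]
    simp only [logWeight, Finset.sum_range_succ]
    congr 2
    ring
  have hpast : history C P Y t ⊔ MeasurableSpace.comap (P t) ⊤ ≤ m0 :=
    sup_le (h.history_le ht.le) (measurable_iff_comap_le.1 (h.measurable_pick ht))
  have hnow : (⨆ x ∈ C t, MeasurableSpace.comap (Y t x) inferInstance) ≤ m0 :=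
    iSup₂_le fun x hx => measurable_iff_comap_le.1 (h.reward_measurable t ht x hx)
  have hGm : MeasurableSet G := h.history_le ht.le _ hG
  have hWm : Measurable[history C P Y t] (W t) := h.measurable_exp_logWeight_left γ ht.le u
  have hGA : ∀ A, MeasurableSet[history C P Y t ⊔ MeasurableSpace.comap (P t) ⊤]
      (G ∩ {ω | P t ω = A}) := fun A =>
    MeasurableSet.inter (le_sup_left (a := history C P Y t) _ hG)
      (le_sup_right (a := history C P Y t) _ ⟨{A}, trivial, rfl⟩)
  have hterm : ∀ A ∈ (C t).powerset, ∫⁻ ω in G ∩ {ω | P t ω = A}, W (t + 1) ω ∂μ ≤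
      ∫⁻ ω in G ∩ {ω | P t ω = A}, W t ω ∂μ := by
    intro A hA
    rw [Finset.mem_powerset] at hA
    have hset := hpast _ (hGA A)
    have hgm : Measurable[⨆ x ∈ C t, MeasurableSpace.comap (Y t x) inferInstance] (g A) := by
      refine Finset.measurable_prod _ fun x hx => ?_
      have hYx : Measurable[⨆ x ∈ C t, MeasurableSpace.comap (Y t x) inferInstance] (Y t x) :=
        measurable_iff_comap_le.2 (le_biSup (fun x => MeasurableSpace.comap (Y t x) inferInstance)
          (hA hx))
      exact ENNReal.measurable_ofReal.comp (Real.measurable_exp.comp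
        (((hYx.sub_const _).const_mul _).sub_const _))
    calc ∫⁻ ω in G ∩ {ω | P t ω = A}, W (t + 1) ω ∂μ
        = ∫⁻ ω, g A ω * (G ∩ {ω | P t ω = A}).indicator (W t) ω ∂μ := by
          rw [← lintegral_indicator hset]
          refine lintegral_congr fun ω => ?_
          by_cases hω : ω ∈ G ∩ {ω | P t ω = A}
          · have hω2 : P t ω = A := hω.2
            rw [Set.indicator_of_mem hω, Set.indicator_of_mem hω, hsucc, hω2, mul_comm]
          · rw [Set.indicator_of_notMem hω, Set.indicator_of_notMem hω, mul_zero]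
      _ = (∫⁻ ω, g A ω ∂μ) * ∫⁻ ω, (G ∩ {ω | P t ω = A}).indicator (W t) ω ∂μ :=
          lintegral_mul_eq_lintegral_mul_lintegral_of_independent_measurableSpace hnow hpast
            (h.reward_indep_past t ht) hgm
            ((hWm.mono le_sup_left le_rfl).indicator (hGA A))
      _ ≤ 1 * ∫⁻ ω, (G ∩ {ω | P t ω = A}).indicator (W t) ω ∂μ := by
          gcongr
          exact h.lintegral_prod_exp_le_one ht hA u
      _ = ∫⁻ ω in G ∩ {ω | P t ω = A}, W t ω ∂μ := by rw [one_mul, lintegral_indicator hset]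
  have hdecomp : ∀ f : Ω → ENNReal, ∫⁻ ω in G, f ω ∂μ =
      ∑ A ∈ (C t).powerset, ∫⁻ ω in G ∩ {ω | P t ω = A}, f ω ∂μ := by
    intro f
    rw [← lintegral_biUnion_finset]
    · congr 2
      ext ω
      simp [h.pick_subset t ht ω]
    · intro A _ B _ hAB
      refine Set.disjoint_left.2 fun ω hωA hωB => hAB ?_
      exact hωA.2.symm.trans hωB.2
    · exact fun A _ => hpast _ (hGA A)
  rw [hdecomp, hdecomp]
  exact Finset.sum_le_sum hterm

end Supermartingale

/-! ### The confidence intervals are valid -/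

section Confidence

variable {d : ℕ} {Ω : Type*} [m0 : MeasurableSpace Ω] {μ : Measure Ω} [IsProbabilityMeasure μ]
  {π : Policy d} {β : Fin d → ℝ} {T : ℕ} {C : ℕ → Finset (Fin d → ℝ)}
  {P : ℕ → Ω → Finset (Fin d → ℝ)} {Y : ℕ → (Fin d → ℝ) → Ω → ℝ}

/-- A self-normalized deviation bound for the error of the ridge estimator. -/
theorem IsInteraction.measure_residual_le (h : IsInteraction π β T C μ P Y) {γ δ : ℝ} (hγ : 0 < γ)
    (hδ : 0 < δ) :
    μ {ω | ∃ t < T, γ * (β ⬝ᵥ β) + 2 * Real.log (2 / δ) +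
        Real.log ((gram γ (fun s => P s ω) t).det / γ ^ d) ≤
      residual γ β (fun s => P s ω) (fun s x => Y s x ω) t ⬝ᵥ (gram γ (fun s => P s ω) t)⁻¹ *ᵥ
        residual γ β (fun s => P s ω) (fun s x => Y s x ω) t} ≤ ENNReal.ofReal (δ / 2) := by
  set N : ℕ → Ω → ENNReal := fun t ω => ∫⁻ u : Fin d → ℝ, ENNReal.ofReal (Real.exp
    (logWeight γ β (fun s => P s ω) (fun s x => Y s x ω) t u)) with hN
  set N₀ : ENNReal := ENNReal.ofReal (1 / √(γ ^ d)) * gaussianMass d with hN₀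
  have hγd : 0 < √(γ ^ d) := by positivity
  -- Before any observation the residual is `-γ β`; its quadratic form cancels the constant `γ/2
  -- ‖β‖²` coming from the centering at `-β`.
  have hN0 : ∀ ω, N 0 ω = N₀ := by
    intro ω
    simp only [hN, lintegral_exp_logWeight hγ, hN₀]
    congr 2
    have hinv : (gram γ (fun s => P s ω) 0)⁻¹ = γ⁻¹ • (1 : Matrix (Fin d) (Fin d) ℝ) := by
      rw [gram_zero]
      apply inv_eq_left_inv
      simp [hγ.ne']
    rw [hinv, gram_zero]
    simp only [residual, Finset.range_zero, Finset.sum_empty, zero_sub, smul_mulVec, one_mulVec,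
      dotProduct_smul, neg_dotProduct, dotProduct_neg, smul_dotProduct, smul_eq_mul, det_smul,
      Fintype.card_fin, det_one, mul_one]
    congr 1
    rw [Real.exp_eq_one_iff]
    field_simp
    ring
  have hN₀pos : N₀ ≠ 0 := mul_ne_zero (by simpa using hγd) gaussianMass_ne_zero
  have hN₀top : N₀ ≠ ⊤ := ENNReal.mul_ne_top ENNReal.ofReal_ne_top gaussianMass_ne_top
  have hville := mul_measure_exists_le_lintegral (μ := μ) (ℱ := history C P Y) (T := T) (N := N)
    history_mono (fun t ht => h.history_le ht.le)
    (fun t ht => by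
      have hm := h.measurable_exp_logWeight_history γ ht.le
      let _ := history C P Y t
      exact hm.lintegral_prod_right')
    (fun t ht G hG => by
      have hswap : ∀ s ≤ T, ∫⁻ ω in G, N s ω ∂μ = ∫⁻ u, ∫⁻ ω in G, ENNReal.ofReal (Real.exp
          (logWeight γ β (fun s => P s ω) (fun s x => Y s x ω) s u)) ∂μ := fun s hs =>
        lintegral_lintegral_swap (h.measurable_exp_logWeight γ hs).aemeasurable
      rw [hswap _ ht, hswap _ ht.le]
      exact lintegral_mono fun u => h.setLIntegral_exp_logWeight_succ_le γ ht hG u)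
    -- This level spends failure probability `δ / 2`; the other half is reserved for the
    -- concentration of the picks.
    (ENNReal.ofReal (2 / δ) * N₀)
  simp only [hN0, lintegral_const, measure_univ, mul_one] at hville
  have hev : μ {ω | ∃ t < T, ENNReal.ofReal (2 / δ) * N₀ ≤ N t ω} ≤ ENNReal.ofReal (δ / 2) := by
    rw [mul_right_comm, mul_comm] at hville
    have h1 := (ENNReal.mul_le_iff_le_inv hN₀pos hN₀top).1 hville
    rw [ENNReal.inv_mul_cancel hN₀pos hN₀top] at h1
    have h2 := (ENNReal.mul_le_iff_le_inv (by simpa using hδ) ENNReal.ofReal_ne_top).1 h1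
    rwa [mul_one, ← ENNReal.ofReal_inv_of_pos (by positivity), inv_div] at h2
  refine (measure_mono ?_).trans hev
  rintro ω ⟨t, ht, hω⟩
  refine ⟨t, ht, ?_⟩
  have hdet := (gram_posDef (P := fun s => P s ω) hγ t).det_pos
  simp only [hN, hN₀, lintegral_exp_logWeight hγ]
  rw [← mul_assoc, ← ENNReal.ofReal_mul (by positivity)]
  gcongr
  set D := (gram γ (fun s => P s ω) t).det
  rw [mul_one_div, div_le_div_iff₀ hγd (Real.sqrt_pos.2 hdet)]
  set q := residual γ β (fun s => P s ω) (fun s x => Y s x ω) t ⬝ᵥ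
    (gram γ (fun s => P s ω) t)⁻¹ *ᵥ residual γ β (fun s => P s ω) (fun s x => Y s x ω) t
  rw [← Real.log_le_log_iff (by positivity) (by positivity), Real.log_mul (by positivity)
    (by positivity), Real.log_mul (by positivity) (by positivity), Real.log_exp,
    Real.log_sqrt hdet.le, Real.log_sqrt (by positivity)]
  rw [Real.log_div hdet.ne' (by positivity)] at hω
  linarith

/-- The set picked lies almost surely in the support of the distribution chosen by the policy. -/
theorem IsInteraction.ae_mem_support (h : IsInteraction π β T C μ P Y) :
    ∀ᵐ ω ∂μ, ∀ t < T, P t ω ∈ (π C (fun s => P s ω) (fun s x => Y s x ω) t).support := by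
  refine ae_all_iff.2 fun t => ?_
  by_cases ht : t < T
  swap
  · exact ae_of_all _ fun ω h' => absurd h' ht
  have hA : ∀ A ∈ (C t).powerset, ∀ᵐ ω ∂μ, P t ω = A →
      π C (fun s => P s ω) (fun s x => Y s x ω) t A ≠ 0 := by
    intro A _
    have hle := h.history_le ht.le
    set q := μ[Set.indicator {ω | P t ω = A} (fun _ => (1 : ℝ)) | history C P Y t] with hq
    have hqm : Measurable[history C P Y t] q := stronglyMeasurable_condExp.measurable
    -- Integrating the conditional probability over its own zero set shows that the event of picking
    -- `A` there is null.
    have hS : MeasurableSet[history C P Y t] (q ⁻¹' {0}) := hqm (measurableSet_singleton 0)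
    have hint : Integrable (Set.indicator {ω | P t ω = A} (fun _ => (1 : ℝ))) μ :=
      (integrable_const _).indicator (h.pick_measurable t ht A)
    have h1 := setIntegral_condExp hle hint hS
    rw [setIntegral_congr_fun (g := fun _ => (0 : ℝ)) (hle _ hS) (fun ω hω => hω),
      integral_zero, setIntegral_indicator (h.pick_measurable t ht A), setIntegral_const] at h1
    simp only [smul_eq_mul, mul_one] at h1
    have h2 : μ (q ⁻¹' {0} ∩ {ω | P t ω = A}) = 0 :=
      (measureReal_eq_zero_iff).1 h1.symm
    have h3 : ∀ᵐ ω ∂μ, ω ∉ q ⁻¹' {0} ∩ {ω | P t ω = A} := measure_eq_zero_iff_ae_notMem.1 h2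
    filter_upwards [h3, h.pick_law t ht A] with ω hω1 hω2 hPA hzero
    refine hω1 ⟨?_, hPA⟩
    rw [Set.mem_preimage, Set.mem_singleton_iff, hq, hω2, hzero]
    simp
  filter_upwards [(Finset.eventually_all _).2 hA] with ω hω _
  rw [PMF.mem_support_iff]
  exact hω _ (Finset.mem_powerset.2 (h.pick_subset t ht ω)) rfl

/-- The confidence width dominates the deviation bound. -/
theorem deviation_le_sq_width {m t : ℕ} {γ δ b : ℝ} (hd : 0 < d) (hm : 0 < m) (hγ : 1 ≤ γ)
    (hδ : 0 < δ) (hδ1 : δ ≤ 1) (hb : (γ = 1 ∧ b ≤ d) ∨ b ≤ 1) :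
    γ * b + 2 * Real.log (2 / δ) + d * Real.log (1 + m * t / γ) ≤
      (√(2 * d * Real.log ((1 + m * (t + 1) / γ) / δ)) + √γ) ^ 2 := by
  have hγ0 : 0 < γ := by linarith
  have hd1 : (1 : ℝ) ≤ d := by exact_mod_cast hd
  have hm1 : (1 : ℝ) ≤ m := by exact_mod_cast hm
  have ht0 : (0 : ℝ) ≤ t := by positivity
  set L := Real.log (1 + m * (t + 1) / γ) with hL
  set L' := Real.log (1 + m * t / γ) with hL'
  set l := -Real.log δ with hl
  have hl0 : 0 ≤ l := by
    have := Real.log_nonpos hδ.le hδ1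
    linarith
  have hLL' : L' ≤ L := by
    apply Real.log_le_log (by positivity)
    gcongr
    linarith
  have hL'0 : 0 ≤ L' := Real.log_nonneg (by
    have : 0 ≤ m * t / γ := by positivity
    linarith)
  have hlog1 : Real.log ((1 + m * (t + 1) / γ) / δ) = L + l := by
    rw [Real.log_div (by positivity) hδ.ne']
    ring
  have hlog2 : Real.log (2 / δ) = Real.log 2 + l := by
    rw [Real.log_div (by norm_num) hδ.ne']
    ring
  have hγL : 1 / 2 ≤ γ * L := by
    have h1 : 1 - (1 + 1 / γ)⁻¹ ≤ Real.log (1 + 1 / γ) :=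
      Real.one_sub_inv_le_log_of_pos (by positivity)
    have h2 : Real.log (1 + 1 / γ) ≤ L := by
      apply Real.log_le_log (by positivity)
      gcongr
      nlinarith
    have h3 : γ * (1 - (1 + 1 / γ)⁻¹) = γ / (γ + 1) := by
      field_simp
      ring
    have h4 : 1 / 2 ≤ γ / (γ + 1) := by
      rw [div_le_div_iff₀ (by norm_num) (by linarith)]
      linarith
    nlinarith
  have hlog2' : Real.log 2 ≤ 1 := by linarith [Real.log_two_lt_d9]
  have hdl : 2 * l ≤ 2 * d * l := by nlinarith
  have hLl : 0 ≤ 2 * d * (L + l) := by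
    have := hL'0.trans hLL'
    positivity
  -- The cross term of the square is at least `2`, which absorbs the `2 log 2` coming from `2 / δ`.
  have hcross : 1 ≤ √(2 * d * (L + l)) * √γ := by
    rw [← Real.sqrt_mul hLl, Real.one_le_sqrt]
    nlinarith [mul_nonneg hγ0.le hl0]
  rw [hlog1, hlog2, add_sq, Real.sq_sqrt hLl, Real.sq_sqrt hγ0.le]
  have hdL' : d * L' ≤ d * L := by gcongr
  rcases hb with ⟨rfl, hb⟩ | hb
  -- For `γ = 1` the bias may be as large as `d` and must be paid from the spare `d L`. For `t ≥ 1`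
  -- one has `L ≥ log 3 > 1`; for `t = 0` only `L ≥ log 2` holds, but `L' = 0` leaves `2 d L`
  -- available.
  · rcases Nat.eq_zero_or_pos t with rfl | ht
    · have hL'z : L' = 0 := by simp [hL']
      have hL2 : Real.log 2 ≤ L := by
        apply Real.log_le_log (by norm_num)
        simp only [CharP.cast_eq_zero, zero_add, mul_one, div_one]
        linarith
      rw [hL'z]
      nlinarith [Real.log_two_gt_d9]
    · have ht1 : (1 : ℝ) ≤ t := by exact_mod_cast ht
      have hL1 : 1 ≤ L := by
        have h3 : (1 : ℝ) < Real.log 3 := by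
          rw [Real.lt_log_iff_exp_lt (by norm_num)]
          linarith [Real.exp_one_lt_d9]
        refine h3.le.trans (Real.log_le_log (by norm_num) ?_)
        rw [div_one]
        nlinarith
      nlinarith
  · have : γ * b ≤ γ := by nlinarith
    have hdL : 0 ≤ d * L := by
      have := hL'0.trans hLL'
      positivity
    nlinarith

/-- In all rounds before `T` the confidence intervals contain the expected rewards. -/
def Confident (m T : ℕ) (γ δ : ℝ) (β : Fin d → ℝ) (C P : ℕ → Finset (Fin d → ℝ))
    (y : ℕ → (Fin d → ℝ) → ℝ) : Prop :=
  ∀ t < T, ∀ x ∈ C t, |ridge γ P y t ⬝ᵥ x - β ⬝ᵥ x| ≤ width m γ δ P t x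

theorem ridgeFair_interval (m : ℕ) (γ δ : ℝ) (P : ℕ → Finset (Fin d → ℝ))
    (y : ℕ → (Fin d → ℝ) → ℝ) (t : ℕ) (x : Fin d → ℝ) :
    ridge γ P y t ⬝ᵥ x - width m γ δ P t x ≤ ridge γ P y t ⬝ᵥ x + width m γ δ P t x := by
  linarith [width_nonneg m γ δ P t x]

theorem IsInteraction.ae_card_le {m : ℕ} {exact : Bool} {γ δ : ℝ}
    (h : IsInteraction (ridgeFair m exact γ δ) β T C μ P Y) :
    ∀ᵐ ω ∂μ, ∀ t < T, (P t ω).card ≤ m := by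
  filter_upwards [h.ae_mem_support] with ω hω t ht
  exact card_le_of_mem_support_pick m exact (ridgeFair_interval m γ δ _ _ t) (hω t ht)

theorem IsInteraction.measure_not_confident_le {m : ℕ} {exact : Bool} {γ δ : ℝ}
    (h : IsInteraction (ridgeFair m exact γ δ) β T C μ P Y) (hd : 0 < d) (hm : 0 < m)
    (hγ : 1 ≤ γ) (hδ : 0 < δ) (hδ1 : δ ≤ 1) (hβ : ∀ i, |β i| ≤ 1)
    (hβγ : γ = 1 ∨ ∑ i, β i ^ 2 ≤ 1) (hC : ∀ t < T, ∀ x ∈ C t, ∀ i, |x i| ≤ 1) :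
    μ {ω | ¬ Confident m T γ δ β C (fun s => P s ω) (fun s x => Y s x ω)} ≤
      ENNReal.ofReal (δ / 2) := by
  have hγ0 : 0 < γ := by linarith
  refine le_trans (measure_mono_ae ?_) (h.measure_residual_le hγ0 hδ)
  filter_upwards [h.ae_card_le] with ω hcard hω
  by_contra hres
  apply hω
  intro t ht x hx
  have hres' : ¬ ∃ t < T, γ * (β ⬝ᵥ β) + 2 * Real.log (2 / δ) +
        Real.log ((gram γ (fun s => P s ω) t).det / γ ^ d) ≤
      residual γ β (fun s => P s ω) (fun s x => Y s x ω) t ⬝ᵥ (gram γ (fun s => P s ω) t)⁻¹ *ᵥ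
        residual γ β (fun s => P s ω) (fun s x => Y s x ω) t := hres
  push Not at hres'
  have h1 := (hres' t ht).le
  have h2 := log_det_gram_div_le (P := fun s => P s ω) hd hγ0 (t := t) (m := m)
    (fun s hs => hcard s (hs.trans ht))
    (fun s hs x hx => hC s (hs.trans ht) x (h.pick_subset s (hs.trans ht) ω hx))
  have h3 := deviation_le_sq_width (t := t) (b := β ⬝ᵥ β) hd hm hγ hδ hδ1 (by
    rcases hβγ with h | h
    · exact Or.inl ⟨h, dotProduct_self_le hβ⟩
    · right
      simpa [dotProduct, sq] using h)
  refine (abs_ridge_sub_le hγ0 β _ t x).trans ?_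
  rw [width]
  gcongr
  rw [Real.sqrt_le_left (by positivity)]
  linarith

end Confidence

/-! ### Measurability of the widths -/

section MeasurableWidth

variable {d : ℕ} {Ω : Type*} {C : ℕ → Finset (Fin d → ℝ)} {P : ℕ → Ω → Finset (Fin d → ℝ)}
  {Y : ℕ → (Fin d → ℝ) → Ω → ℝ}

theorem measurable_dotProduct_inv_mulVec (x : Fin d → ℝ) :
    Measurable (fun M : Fin d → Fin d → ℝ => x ⬝ᵥ (Matrix.of M)⁻¹ *ᵥ x) := by
  have hdet : Continuous (fun M : Fin d → Fin d → ℝ => (Matrix.of M).det) :=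
    Continuous.matrix_det (A := fun M : Fin d → Fin d → ℝ => Matrix.of M) continuous_id
  have hadj : ∀ i j, Continuous (fun M : Fin d → Fin d → ℝ => (Matrix.of M).adjugate i j) :=
    fun i j => (Continuous.matrix_adjugate (A := fun M : Fin d → Fin d → ℝ => Matrix.of M)
      continuous_id).matrix_elem i j
  simp only [Matrix.inv_def, Ring.inverse_eq_inv', dotProduct, mulVec, Matrix.smul_apply,
    smul_eq_mul]
  exact Finset.measurable_sum _ fun i _ => (Finset.measurable_sum _ fun j _ =>
    (hdet.measurable.inv.mul (hadj i j).measurable).mul_const _).const_mul _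

theorem measurable_width {m : ℕ} {γ δ : ℝ} (t : ℕ) (x : Fin d → ℝ) :
    Measurable[history C P Y t] (fun ω => width m γ δ (fun s => P s ω) t x) := by
  have hgram : Measurable[history C P Y t]
      (fun ω => (fun i j => gram γ (fun s => P s ω) t i j : Fin d → Fin d → ℝ)) := by
    refine @measurable_pi_lambda _ _ _ (history C P Y t) _ _ fun i =>
      @measurable_pi_lambda _ _ _ (history C P Y t) _ _ fun j => ?_
    simp only [gram, Matrix.add_apply, Matrix.sum_apply]
    refine Measurable.add_const (Finset.measurable_sum _ fun s hs => ?_) _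
    have h1 : Measurable[⊤] (fun A : Finset (Fin d → ℝ) => ∑ x ∈ A, vecMulVec x x i j) :=
      fun _ _ => trivial
    exact h1.comp (measurable_pick_history (Finset.mem_range.1 hs))
  have h2 := (measurable_dotProduct_inv_mulVec x).comp hgram
  exact (Real.continuous_sqrt.measurable.comp h2).mul_const _

end MeasurableWidth

/-! ### Conditional means and realized values -/

section Multiplicative

variable {d : ℕ} {Ω : Type*} [m0 : MeasurableSpace Ω] {μ : Measure Ω} [IsProbabilityMeasure μ]
  {π : Policy d} {β : Fin d → ℝ} {T : ℕ} {C : ℕ → Finset (Fin d → ℝ)}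
  {P : ℕ → Ω → Finset (Fin d → ℝ)} {Y : ℕ → (Fin d → ℝ) → Ω → ℝ}

theorem exp_neg_le_one_sub_half {r : ℝ} (h0 : 0 ≤ r) (h1 : r ≤ 1) : Real.exp (-r) ≤ 1 - r / 2 := by
  rw [Real.exp_neg]
  refine (inv_anti₀ (by linarith) (Real.add_one_le_exp r)).trans ?_
  rw [inv_le_iff_one_le_mul₀ (by linarith)]
  nlinarith

/-- The conditional probability of picking `A` in round `t`. -/
def condPick (C : ℕ → Finset (Fin d → ℝ)) (μ : Measure Ω) (P : ℕ → Ω → Finset (Fin d → ℝ))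
    (Y : ℕ → (Fin d → ℝ) → Ω → ℝ) (t : ℕ) (A : Finset (Fin d → ℝ)) : Ω → ℝ :=
  μ[Set.indicator {ω | P t ω = A} (fun _ => (1 : ℝ)) | history C P Y t]

/-- The pull-out property: a bounded factor known from the history sees the pick only through its
conditional probability. -/
theorem integral_mul_indicator_pick (h : IsInteraction π β T C μ P Y) {t : ℕ} (ht : t < T)
    (A : Finset (Fin d → ℝ)) {g : Ω → ℝ} (hg : Measurable[history C P Y t] g) {b : ℝ}
    (hb : ∀ᵐ ω ∂μ, |g ω| ≤ b) :
    ∫ ω, g ω * Set.indicator {ω | P t ω = A} (fun _ => (1 : ℝ)) ω ∂μ =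
      ∫ ω, g ω * condPick C μ P Y t A ω ∂μ := by
  have hle := h.history_le ht.le
  have hint : Integrable (Set.indicator {ω | P t ω = A} (fun _ => (1 : ℝ))) μ :=
    (integrable_const _).indicator (h.pick_measurable t ht A)
  have hgi : Integrable (g * Set.indicator {ω | P t ω = A} (fun _ => (1 : ℝ))) μ :=
    hint.bdd_mul (c := b) (hg.mono hle le_rfl).aestronglyMeasurable (by simpa using hb)
  have h1 := condExp_mul_of_stronglyMeasurable_left hg.stronglyMeasurable hgi hint
  rw [← integral_condExp hle (f := fun ω => g ω *
    Set.indicator {ω | P t ω = A} (fun _ => (1 : ℝ)) ω)]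
  exact integral_congr_ae h1

theorem sum_toReal_le_one (p : PMF (Finset (Fin d → ℝ))) (S : Finset (Finset (Fin d → ℝ))) :
    ∑ A ∈ S, (p A).toReal ≤ 1 := by
  rw [← ENNReal.toReal_sum fun A _ => p.apply_ne_top A]
  refine ENNReal.toReal_le_of_le_ofReal zero_le_one ?_
  rw [ENNReal.ofReal_one, ← p.tsum_coe]
  exact ENNReal.sum_le_tsum S

/-- The conditional mean of the sum of `f` along the run is at most twice the realized sum, up to
a logarithmic term. -/
theorem IsInteraction.measure_sum_condMean_le (h : IsInteraction π β T C μ P Y)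
    {f : ℕ → Finset (Fin d → ℝ) → Ω → ℝ}
    (hf : ∀ t < T, ∀ A, Measurable[history C P Y t] (f t A))
    (hf0 : ∀ t A ω, 0 ≤ f t A ω) (hf1 : ∀ t A ω, f t A ω ≤ 1) {δ : ℝ} (hδ : 0 < δ) :
    μ {ω | 2 * ∑ t ∈ Finset.range T, f t (P t ω) ω + 2 * Real.log (2 / δ) <
      ∑ t ∈ Finset.range T, ∑ A ∈ (C t).powerset,
        (π C (fun s => P s ω) (fun s x => Y s x ω) t A).toReal * f t A ω} ≤
      ENNReal.ofReal (δ / 2) := by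
  -- No measurability of the policy is assumed. The conditional probabilities are measurable
  -- versions of its values, equal almost surely, and are exchanged back only at the end.
  set q := condPick C μ P Y with hq
  have hqm : ∀ t A, Measurable[history C P Y t] (q t A) := fun t A =>
    stronglyMeasurable_condExp.measurable
  set p : ℕ → Ω → ℝ := fun t ω => ∑ A ∈ (C t).powerset, q t A ω * f t A ω with hp
  have hpm : ∀ t < T, Measurable[history C P Y t] (p t) := fun t ht =>
    Finset.measurable_sum _ fun A _ => (hqm t A).mul (hf t ht A)
  have hlaw : ∀ᵐ ω ∂μ, ∀ t < T, ∀ A ∈ (C t).powerset,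
      q t A ω = (π C (fun s => P s ω) (fun s x => Y s x ω) t A).toReal := by
    refine ae_all_iff.2 fun t => ?_
    by_cases ht : t < T
    · filter_upwards [(Finset.eventually_all _).2 fun A _ => h.pick_law t ht A] with ω hω _
      exact hω
    · exact ae_of_all _ fun ω h' => absurd h' ht
  have hq0 : ∀ᵐ ω ∂μ, ∀ t < T, ∀ A ∈ (C t).powerset, 0 ≤ q t A ω := by
    filter_upwards [hlaw] with ω hω t ht A hA
    rw [hω t ht A hA]
    exact ENNReal.toReal_nonneg
  have hq1 : ∀ᵐ ω ∂μ, ∀ t < T, ∑ A ∈ (C t).powerset, q t A ω ≤ 1 := by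
    filter_upwards [hlaw] with ω hω t ht
    rw [Finset.sum_congr rfl fun A hA => hω t ht A hA]
    exact sum_toReal_le_one _ _
  have hp1 : ∀ᵐ ω ∂μ, ∀ t < T, p t ω ≤ 1 := by
    filter_upwards [hq0, hq1] with ω h0 h1 t ht
    exact (Finset.sum_le_sum fun A hA => mul_le_of_le_one_right (h0 t ht A hA) (hf1 t A ω)).trans
      (h1 t ht)
  set X : ℕ → Ω → ℝ := fun t ω => f t (P t ω) ω with hX
  have hXeq : ∀ t < T, ∀ ω (k : ℝ → ℝ), k (X t ω) = ∑ A ∈ (C t).powerset,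
      k (f t A ω) * Set.indicator {ω | P t ω = A} (fun _ => (1 : ℝ)) ω := by
    intro t ht ω k
    rw [Finset.sum_eq_single (P t ω)]
    · simp [hX]
    · intro A _ hA
      have hn : ω ∉ {ω | P t ω = A} := fun h' => hA (Eq.symm h')
      rw [Set.indicator_of_notMem hn, mul_zero]
    · exact fun h' => absurd (Finset.mem_powerset.2 (h.pick_subset t ht ω)) h'
  have hXm : ∀ s t, s < t → t ≤ T → Measurable[history C P Y t] (X s) := by
    intro s t hst htT
    have heq : X s = fun ω => ∑ A ∈ (C s).powerset,
      f s A ω * Set.indicator {ω | P s ω = A} (fun _ => (1 : ℝ)) ω :=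
        funext fun ω => hXeq s (hst.trans_le htT) ω id
    rw [heq]
    refine Finset.measurable_sum _ fun A _ => ?_
    refine ((hf s (hst.trans_le htT) A).mono (history_mono s t hst.le) le_rfl).mul ?_
    exact measurable_const.indicator (measurable_pick_history hst
      (show MeasurableSet[⊤] {B | B = A} from trivial))
  -- This is a supermartingale: given the history, the mean of `exp(-X)` is at most `1 - p/2 ≤
  -- exp(-p/2)`, since `X` lies in `[0,1]` and has conditional mean `p`. Markov's inequality at time
  -- `T` then gives the claim.
  set E : ℕ → Ω → ℝ := fun t ω => Real.exp (∑ s ∈ Finset.range t, (p s ω / 2 - X s ω)) with hE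
  have hEm : ∀ t ≤ T, Measurable[history C P Y t] (E t) := by
    intro t ht
    refine Real.measurable_exp.comp (Finset.measurable_sum _ fun s hs => ?_)
    rw [Finset.mem_range] at hs
    exact (((hpm s (hs.trans_le ht)).mono (history_mono s t hs.le) le_rfl).div_const 2).sub
      (hXm s t hs ht)
  have hEb : ∀ t ≤ T, ∀ᵐ ω ∂μ, |E t ω| ≤ Real.exp t := by
    intro t ht
    filter_upwards [hp1] with ω hω
    rw [hE, abs_of_pos (Real.exp_pos _), Real.exp_le_exp]
    calc ∑ s ∈ Finset.range t, (p s ω / 2 - X s ω) ≤ ∑ _s ∈ Finset.range t, (1 : ℝ) := by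
          refine Finset.sum_le_sum fun s hs => ?_
          have h1 := hω s ((Finset.mem_range.1 hs).trans_le ht)
          have h2 : 0 ≤ X s ω := hf0 _ _ _
          linarith
      _ = t := by simp
  have hEi : ∀ t ≤ T, Integrable (E t) μ := fun t ht =>
    Integrable.of_bound ((hEm t ht).mono (h.history_le ht) le_rfl).aestronglyMeasurable
      (Real.exp t) (hEb t ht)
  have hmean : ∀ t ≤ T, ∫ ω, E t ω ∂μ ≤ 1 := by
    intro t ht
    induction t with
    | zero => simp [hE]
    | succ t ih =>
      have htT : t < T := ht
      refine le_trans ?_ (ih htT.le)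
      set G : Finset (Fin d → ℝ) → Ω → ℝ := fun A ω =>
        E t ω * Real.exp (p t ω / 2) * Real.exp (-f t A ω) with hG
      have hGm : ∀ A, Measurable[history C P Y t] (G A) := fun A =>
        ((hEm t htT.le).mul (Real.measurable_exp.comp ((hpm t htT).div_const 2))).mul
          (Real.measurable_exp.comp (hf t htT A).neg)
      have hGb : ∀ A, ∀ᵐ ω ∂μ, |G A ω| ≤ Real.exp t * Real.exp 1 * 1 := by
        intro A
        filter_upwards [hEb t htT.le, hp1] with ω h1 h2
        simp only [hG]
        rw [abs_mul, abs_mul, abs_of_pos (Real.exp_pos (p t ω / 2)),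
          abs_of_pos (Real.exp_pos (-f t A ω))]
        gcongr
        · linarith [h2 t htT]
        · rw [Real.exp_le_one_iff]
          linarith [hf0 t A ω]
      have hGi : ∀ A, Integrable (G A) μ := fun A =>
        Integrable.of_bound ((hGm A).mono (h.history_le htT.le) le_rfl).aestronglyMeasurable _
          (hGb A)
      have hsplit : ∀ ω, E (t + 1) ω = ∑ A ∈ (C t).powerset,
          G A ω * Set.indicator {ω | P t ω = A} (fun _ => (1 : ℝ)) ω := by
        intro ω
        have hE1 : E (t + 1) ω = E t ω * Real.exp (p t ω / 2) * Real.exp (-X t ω) := by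
          simp only [hE, Finset.sum_range_succ, Real.exp_add, sub_eq_add_neg, mul_assoc]
        rw [hE1, hXeq t htT ω (fun r => Real.exp (-r)), Finset.mul_sum]
        exact Finset.sum_congr rfl fun A _ => by simp only [hG]; ring
      have hqi : ∀ A, Integrable (fun ω => G A ω * q t A ω) μ := fun A =>
        integrable_condExp.bdd_mul ((hGm A).mono (h.history_le htT.le) le_rfl).aestronglyMeasurable
          (by simpa using hGb A)
      calc ∫ ω, E (t + 1) ω ∂μ
          = ∑ A ∈ (C t).powerset,
              ∫ ω, G A ω * Set.indicator {ω | P t ω = A} (fun _ => (1 : ℝ)) ω ∂μ := by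
            simp only [hsplit]
            refine integral_finsetSum _ fun A _ => ?_
            exact ((integrable_const _).indicator (h.pick_measurable t htT A)).bdd_mul
              ((hGm A).mono (h.history_le htT.le) le_rfl).aestronglyMeasurable
              (by simpa using hGb A)
        _ = ∑ A ∈ (C t).powerset, ∫ ω, G A ω * q t A ω ∂μ :=
            Finset.sum_congr rfl fun A _ => integral_mul_indicator_pick h htT A (hGm A) (hGb A)
        _ = ∫ ω, ∑ A ∈ (C t).powerset, G A ω * q t A ω ∂μ :=
            (integral_finsetSum _ fun A _ => hqi A).symm
        _ ≤ ∫ ω, E t ω ∂μ := by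
            refine integral_mono_ae (integrable_finsetSum _ fun A _ => hqi A) (hEi t htT.le) ?_
            filter_upwards [hq0, hq1] with ω h0 h1
            have hsum : ∑ A ∈ (C t).powerset, Real.exp (-f t A ω) * q t A ω ≤
                Real.exp (-(p t ω / 2)) := by
              calc ∑ A ∈ (C t).powerset, Real.exp (-f t A ω) * q t A ω
                  ≤ ∑ A ∈ (C t).powerset, (1 - f t A ω / 2) * q t A ω :=
                    Finset.sum_le_sum fun A hA => mul_le_mul_of_nonneg_right
                      (exp_neg_le_one_sub_half (hf0 t A ω) (hf1 t A ω)) (h0 t htT A hA)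
                _ = ∑ A ∈ (C t).powerset, q t A ω - p t ω / 2 := by
                    simp only [hp]
                    rw [Finset.sum_div, ← Finset.sum_sub_distrib]
                    exact Finset.sum_congr rfl fun A _ => by ring
                _ ≤ -(p t ω / 2) + 1 := by linarith [h1 t htT]
                _ ≤ Real.exp (-(p t ω / 2)) := Real.add_one_le_exp _
            calc ∑ A ∈ (C t).powerset, G A ω * q t A ω
                = E t ω * Real.exp (p t ω / 2) *
                    ∑ A ∈ (C t).powerset, Real.exp (-f t A ω) * q t A ω := by
                  rw [Finset.mul_sum]
                  exact Finset.sum_congr rfl fun A _ => by simp only [hG]; ring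
              _ ≤ E t ω * Real.exp (p t ω / 2) * Real.exp (-(p t ω / 2)) := by
                  have : 0 < E t ω := Real.exp_pos _
                  gcongr
              _ = E t ω := by rw [mul_assoc, ← Real.exp_add]; simp
  have hmarkov := mul_meas_ge_le_integral_of_nonneg (μ := μ) (f := E T)
    (ae_of_all _ fun ω => (Real.exp_pos _).le) (hEi T le_rfl) (2 / δ)
  have hreal : μ.real {ω | 2 / δ ≤ E T ω} ≤ δ / 2 := by
    have h1 := hmarkov.trans (hmean T le_rfl)
    rw [mul_comm, ← le_div_iff₀ (by positivity), one_div_div] at h1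
    exact h1
  have hev : μ {ω | 2 / δ ≤ E T ω} ≤ ENNReal.ofReal (δ / 2) := by
    rw [← ENNReal.ofReal_toReal (measure_ne_top μ {ω | 2 / δ ≤ E T ω})]
    exact ENNReal.ofReal_le_ofReal hreal
  refine le_trans (measure_mono_ae ?_) hev
  filter_upwards [hlaw] with ω hω hlt
  change 2 / δ ≤ Real.exp (∑ s ∈ Finset.range T, (p s ω / 2 - X s ω))
  rw [← Real.log_le_iff_le_exp (by positivity), Finset.sum_sub_distrib, ← Finset.sum_div]
  have hpeq : ∑ t ∈ Finset.range T, p t ω = ∑ t ∈ Finset.range T, ∑ A ∈ (C t).powerset,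
      (π C (fun s => P s ω) (fun s x => Y s x ω) t A).toReal * f t A ω :=
    Finset.sum_congr rfl fun t ht => Finset.sum_congr rfl fun A hA => by
      rw [hω t (Finset.mem_range.1 ht) A hA]
  have hlt' : 2 * ∑ t ∈ Finset.range T, X t ω + 2 * Real.log (2 / δ) <
      ∑ t ∈ Finset.range T, p t ω := hpeq ▸ hlt
  linarith

end Multiplicative

/-! ### Sums of confidence widths -/

section Widths

variable {d : ℕ}

theorem width_le {m T t : ℕ} {γ δ : ℝ} (hγ : 1 ≤ γ) (hδ : 0 < δ) (ht : t < T)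
    (P : ℕ → Finset (Fin d → ℝ)) (x : Fin d → ℝ) :
    width m γ δ P t x ≤ √(x ⬝ᵥ (gram γ P t)⁻¹ *ᵥ x) *
      (√(2 * d * Real.log ((1 + m * T) / δ)) + √γ) := by
  have htT : (t : ℝ) + 1 ≤ T := by exact_mod_cast ht
  rw [width]
  gcongr
  calc (m : ℝ) * (t + 1) / γ ≤ m * (t + 1) := div_le_self (by positivity) hγ
    _ ≤ m * T := by gcongr

/-- Moves the truncation from the width to the squared norm, where the potential lemma needs it;
this is why `b ≥ 1` is required. -/
theorem min_one_sqrt_mul_le {u w b : ℝ} (hb : 1 ≤ b) (hw : w ≤ √u * b) :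
    min 1 w ≤ √(min 1 u) * b := by
  rcases le_total 1 u with h | h
  · rw [min_eq_left h, Real.sqrt_one, one_mul]
    exact (min_le_left _ _).trans hb
  · rw [min_eq_right h]
    exact (min_le_right _ _).trans hw

theorem half_le_log {m T : ℕ} {δ : ℝ} (hm : 0 < m) (hT : 0 < T) (hδ : 0 < δ) (hδ1 : δ ≤ 1) :
    1 / 2 ≤ Real.log ((1 + m * T) / δ) ∧ Real.log (2 / δ) ≤ Real.log ((1 + m * T) / δ) := by
  have hmT : (1 : ℝ) ≤ m * T := by exact_mod_cast Nat.mul_pos hm hT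
  have h1 : Real.log (2 / δ) ≤ Real.log ((1 + m * T) / δ) := by
    apply Real.log_le_log (by positivity)
    gcongr
    linarith
  refine ⟨le_trans ?_ h1, h1⟩
  have h2 : Real.log 2 ≤ Real.log (2 / δ) := by
    apply Real.log_le_log (by norm_num)
    rw [le_div_iff₀ hδ]
    linarith
  linarith [Real.log_two_gt_d9]

theorem sum_min_one_width_le {m T : ℕ} {γ δ : ℝ} {P : ℕ → Finset (Fin d → ℝ)} (hd : 0 < d)
    (hm : 0 < m) (hT : 0 < T) (hγ : 1 ≤ γ) (hδ : 0 < δ) (hδ1 : δ ≤ 1)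
    (hcard : ∀ t < T, (P t).card ≤ m) (hx : ∀ t < T, ∀ x ∈ P t, ∀ i, |x i| ≤ 1) :
    ∑ t ∈ Finset.range T, ∑ x ∈ P t, min 1 (width m γ δ P t x) ≤
      4 * (d * m * √(γ * T) * Real.log ((1 + m * T) / δ)) := by
  have hγ0 : 0 < γ := by linarith
  have hd1 : (1 : ℝ) ≤ d := by exact_mod_cast hd
  set Λ := Real.log ((1 + m * T) / δ) with hΛ
  have hΛ2 : 1 / 2 ≤ Λ := (half_le_log hm hT hδ hδ1).1
  set a := 2 * d * Λ with ha
  -- With `a, γ ≥ 1` one has `a + √γ √a ≤ 2 √γ a`, which merges both parts of the width into one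
  -- term; with `a = 2 d Λ` this gives the constant `4`.
  have ha1 : 1 ≤ a := by nlinarith
  have hsqa : √a ≤ a := by
    rw [Real.sqrt_le_left (by linarith)]
    nlinarith
  have hsqγ : 1 ≤ √γ := Real.one_le_sqrt.2 hγ
  set b := √a + √γ with hb
  have hb1 : 1 ≤ b := by linarith [Real.sqrt_nonneg a]
  set f : (Σ _ : ℕ, Fin d → ℝ) → ℝ := fun p => √(min 1 (p.2 ⬝ᵥ (gram γ P p.1)⁻¹ *ᵥ p.2)) with hf
  have h1 : ∑ t ∈ Finset.range T, ∑ x ∈ P t, min 1 (width m γ δ P t x) ≤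
      (∑ p ∈ (Finset.range T).sigma P, f p) * b := by
    rw [Finset.sum_sigma, Finset.sum_mul]
    refine Finset.sum_le_sum fun t ht => ?_
    rw [Finset.sum_mul]
    exact Finset.sum_le_sum fun x _ => min_one_sqrt_mul_le hb1
      (width_le hγ hδ (Finset.mem_range.1 ht) P x)
  have hpot : ∑ p ∈ (Finset.range T).sigma P, f p ^ 2 ≤ m * a := by
    have h2 : ∑ p ∈ (Finset.range T).sigma P, f p ^ 2 =
        ∑ t ∈ Finset.range T, ∑ x ∈ P t, min 1 (x ⬝ᵥ (gram γ P t)⁻¹ *ᵥ x) := by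
      rw [Finset.sum_sigma]
      refine Finset.sum_congr rfl fun t _ => Finset.sum_congr rfl fun x _ => ?_
      exact Real.sq_sqrt (le_min zero_le_one (dotProduct_inv_mulVec_nonneg (gram_posDef hγ0 t) x))
    have h3 := sum_min_one_le (P := P) hγ0 T hcard
    have h4 := log_det_gram_div_le hd hγ0 hcard hx
    have h5 : Real.log (1 + m * T / γ) ≤ Λ := by
      apply Real.log_le_log (by positivity)
      calc (1 : ℝ) + m * T / γ ≤ 1 + m * T := by
            gcongr
            exact div_le_self (by positivity) hγ
        _ ≤ (1 + m * T) / δ := by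
            rw [le_div_iff₀ hδ]
            exact mul_le_of_le_one_right (by positivity) hδ1
    rw [h2]
    refine h3.trans ?_
    calc 2 * (m : ℝ) * Real.log ((gram γ P T).det / γ ^ d) ≤ 2 * m * (d * Λ) := by
          gcongr
          exact h4.trans (by gcongr)
      _ = m * a := by rw [ha]; ring
  have hcs := sq_sum_le_card_mul_sum_sq (s := (Finset.range T).sigma P) (f := f)
  have hN : (((Finset.range T).sigma P).card : ℝ) ≤ m * T := by
    rw [Finset.card_sigma]
    have := Finset.sum_le_card_nsmul (Finset.range T) (fun t => (P t).card) m
      (fun t ht => hcard t (Finset.mem_range.1 ht))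
    rw [Finset.card_range, smul_eq_mul, mul_comm] at this
    exact_mod_cast this
  have hsum : ∑ p ∈ (Finset.range T).sigma P, f p ≤ m * √T * √a := by
    apply le_of_sq_le_sq _ (by positivity)
    rw [mul_pow, mul_pow, Real.sq_sqrt (by positivity), Real.sq_sqrt (by linarith)]
    calc _ ≤ _ := hcs
      _ ≤ m * T * (m * a) := by gcongr
      _ = _ := by ring
  refine h1.trans ?_
  calc (∑ p ∈ (Finset.range T).sigma P, f p) * b ≤ (m * √T * √a) * b := by gcongr
    _ = m * √T * (a + √γ * √a) := by
        have : √a * √a = a := Real.mul_self_sqrt (by linarith)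
        rw [hb]
        linear_combination (m * √T) * this
    _ ≤ m * √T * (√γ * a + √γ * a) := by
        gcongr
        nlinarith
    _ = _ := by
        rw [Real.sqrt_mul hγ0.le, ha]
        ring

end Widths

/-! ### Marginals as expectations -/

section Expectation

variable {α : Type*} [DecidableEq α] {C : Finset α} {lo up : α → ℝ}

theorem subset_of_mem_support_pick (m : ℕ) (exact : Bool) (hlo : ∀ x, lo x ≤ up x) {A : Finset α}
    (hA : A ∈ (pick m exact C lo up).support) : A ⊆ C := by
  obtain ⟨F, hF, hFm, -, ⟨h1, -⟩ | ⟨z, hzC, hzF, hz, hcard, hFm', hne, h1⟩⟩ :=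
    pick_cases (C := C) m exact hlo
  · rw [h1, PMF.support_pure, Set.mem_singleton_iff] at hA
    exact hA ▸ hF.1
  · rw [h1, PMF.mem_support_map_iff] at hA
    obtain ⟨Q, hQ, rfl⟩ := hA
    rw [PMF.mem_support_uniformOfFinset_iff, Finset.mem_powersetCard] at hQ
    exact Finset.union_subset hF.1 (hQ.1.trans (chain_subset z))

theorem sum_marginal_mul {p : PMF (Finset α)} (hp : ∀ A ∈ p.support, A ⊆ C) (g : α → ℝ) :
    ∑ x ∈ C, (marginal p x).toReal * g x =
      ∑ A ∈ C.powerset, (p A).toReal * ∑ x ∈ A, g x := by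
  have hmarg : ∀ x, (marginal p x).toReal =
      ∑ A ∈ C.powerset, if x ∈ A then (p A).toReal else 0 := by
    intro x
    have h1 : marginal p x = ∑ A ∈ C.powerset, if x ∈ A then p A else 0 := by
      rw [marginal, PMF.toOuterMeasure_apply, tsum_eq_sum (s := C.powerset)]
      · exact Finset.sum_congr rfl fun A _ => by simp [Set.indicator_apply]
      · intro A hA
        have : p A = 0 := by
          by_contra h0
          exact hA (Finset.mem_powerset.2 (hp A ((PMF.mem_support_iff _ _).2 h0)))
        simp [Set.indicator_apply, this]
    rw [h1, ENNReal.toReal_sum]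
    · exact Finset.sum_congr rfl fun A _ => by split_ifs <;> simp
    · intro A _
      split_ifs
      · exact p.apply_ne_top A
      · simp
  simp only [hmarg, Finset.sum_mul]
  rw [Finset.sum_comm]
  refine Finset.sum_congr rfl fun A hA => ?_
  rw [Finset.mem_powerset] at hA
  rw [Finset.mul_sum, ← Finset.sum_subset hA]
  · exact Finset.sum_congr rfl fun x hx => by rw [if_pos hx]
  · intro x _ hx
    rw [if_neg hx, zero_mul]

end Expectation

/-! ### Benchmarks -/

section Benchmarks

variable {d : ℕ} {β : Fin d → ℝ} {C : Finset (Fin d → ℝ)}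

theorem exists_bestExact_eq {m : ℕ} (hm : m ≤ C.card) :
    ∃ A ⊆ C, A.card = m ∧ bestExact β m C = setReward β A := by
  have hfin : {A | A ⊆ C ∧ A.card = m}.Finite :=
    C.powerset.finite_toSet.subset fun A hA => by simpa using hA.1
  obtain ⟨A₀, hA₀, hA₀m⟩ := Finset.exists_subset_card_eq hm
  have hne : {A | A ⊆ C ∧ A.card = m}.Nonempty := ⟨A₀, hA₀, hA₀m⟩
  obtain ⟨A, hA, hAeq⟩ := (hne.image (setReward β)).csSup_mem (hfin.image _)
  exact ⟨A, hA.1, hA.2, hAeq.symm⟩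

theorem exists_bestUnconstrained_eq : ∃ A ⊆ C, bestUnconstrained β C = setReward β A := by
  have hfin : {A | A ⊆ C}.Finite := C.powerset.finite_toSet.subset fun A hA => by simpa using hA
  have hne : {A | A ⊆ C}.Nonempty := ⟨C, Finset.Subset.refl C⟩
  obtain ⟨A, hA, hAeq⟩ := (hne.image (setReward β)).csSup_mem (hfin.image _)
  exact ⟨A, hA, hAeq.symm⟩

theorem abs_setReward_le {A : Finset (Fin d → ℝ)} {m : ℕ} (hA : ∀ x ∈ A, |β ⬝ᵥ x| ≤ 1)
    (hm : A.card ≤ m) : |setReward β A| ≤ m := by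
  calc |setReward β A| ≤ ∑ x ∈ A, |β ⬝ᵥ x| := Finset.abs_sum_le_sum_abs _ _
    _ ≤ ∑ _x ∈ A, (1 : ℝ) := Finset.sum_le_sum hA
    _ = A.card := by simp
    _ ≤ m := by exact_mod_cast hm

end Benchmarks

/-! ### The regret of RidgeFair -/

section Regret

variable {d : ℕ} {Ω : Type*} [m0 : MeasurableSpace Ω] {μ : Measure Ω} {β : Fin d → ℝ} {T : ℕ}
  {C : ℕ → Finset (Fin d → ℝ)} {P : ℕ → Ω → Finset (Fin d → ℝ)} {Y : ℕ → (Fin d → ℝ) → Ω → ℝ}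

theorem IsInteraction.measurable_regret {π : Policy d} (h : IsInteraction π β T C μ P Y)
    (best : Finset (Fin d → ℝ) → ℝ) :
    Measurable fun ω => regret β best T C (fun t => P t ω) := by
  refine Finset.measurable_sum _ fun t ht => measurable_const.sub ?_
  have h1 : Measurable[⊤] (setReward β) := fun _ _ => trivial
  exact h1.comp (h.measurable_pick (Finset.mem_range.1 ht))

variable [IsProbabilityMeasure μ]

/-- Off the bad event the regret is at most `B'`, and on it at most `b`. The expected regret
therefore exceeds `B'` by at most `b δ`, hence the slack between `B'` and `B`. -/
theorem regretAtMost_of_measure_le {R : Ω → ℝ} (hR : Measurable R) {δ b B B' : ℝ} (hδ : 0 ≤ δ)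
    (hb : 0 ≤ b) (hRb : ∀ᵐ ω ∂μ, |R ω| ≤ b) (hB' : 0 ≤ B') (hB'B : B' ≤ B)
    (hprob : μ {ω | B' < R ω} ≤ ENNReal.ofReal δ) (hexp : δ * √T ≤ 1 → B' + b * δ ≤ B) :
    RegretAtMost μ R T δ B := by
  refine ⟨(measure_mono fun ω hω => hB'B.trans_lt hω).trans hprob, fun hδT => ?_⟩
  have hRi : Integrable R μ := Integrable.of_bound hR.aestronglyMeasurable b hRb
  refine ⟨hRi, ?_⟩
  have hset : MeasurableSet {ω | B' < R ω} := measurableSet_lt measurable_const hR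
  have hind : Integrable ({ω | B' < R ω}.indicator fun _ => b) μ :=
    (integrable_const b).indicator hset
  calc ∫ ω, R ω ∂μ ≤ ∫ ω, (B' + {ω | B' < R ω}.indicator (fun _ => b) ω) ∂μ := by
        refine integral_mono_ae hRi ((integrable_const _).add hind) ?_
        filter_upwards [hRb] with ω hω
        by_cases h : ω ∈ {ω | B' < R ω}
        · rw [Set.indicator_of_mem h]
          linarith [(abs_le.1 hω).2]
        · rw [Set.indicator_of_notMem h, add_zero]
          exact not_lt.1 h
    _ = B' + μ.real {ω | B' < R ω} * b := by
        rw [integral_add (integrable_const _) hind, integral_indicator hset]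
        simp
    _ ≤ B' + b * δ := by
        rw [mul_comm b]
        gcongr
        exact ENNReal.toReal_le_of_le_ofReal hδ hprob
    _ ≤ B := hexp hδT

theorem IsInteraction.abs_mean_le_one {π : Policy d} (h : IsInteraction π β T C μ P Y) {t : ℕ}
    (ht : t < T) {x : Fin d → ℝ} (hx : x ∈ C t) : |β ⬝ᵥ x| ≤ 1 := by
  rw [← h.reward_mean t ht x hx]
  have := norm_integral_le_of_norm_le_const (μ := μ) (f := Y t x) (C := 1) (by
    filter_upwards [h.reward_mem t ht x hx] with ω hω
    exact abs_le.2 hω)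
  simpa using this

theorem IsInteraction.ae_abs_regret_le {m : ℕ} {exact : Bool} {γ δ : ℝ}
    (h : IsInteraction (ridgeFair m exact γ δ) β T C μ P Y) {best : Finset (Fin d → ℝ) → ℝ}
    (hbest : ∀ t < T, |best (C t)| ≤ m) :
    ∀ᵐ ω ∂μ, |regret β best T C (fun t => P t ω)| ≤ 2 * m * T := by
  filter_upwards [h.ae_card_le] with ω hω
  calc |regret β best T C (fun t => P t ω)|
      ≤ ∑ t ∈ Finset.range T, |best (C t) - setReward β (P t ω)| := Finset.abs_sum_le_sum_abs _ _
    _ ≤ ∑ _t ∈ Finset.range T, (2 * m : ℝ) := by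
        refine Finset.sum_le_sum fun t ht => (abs_sub _ _).trans ?_
        rw [Finset.mem_range] at ht
        have h1 := abs_setReward_le
          (fun x hx => h.abs_mean_le_one ht (h.pick_subset t ht ω hx)) (hω t ht)
        linarith [hbest t ht]
    _ = 2 * m * T := by simp; ring

theorem IsInteraction.regretAtMost {m k : ℕ} {exact : Bool} {γ δ : ℝ}
    (h : IsInteraction (ridgeFair m exact γ δ) β T C μ P Y) (hd : 0 < d)
    (hγ : 1 ≤ γ) (hδ : 0 < δ) (hδ1 : δ ≤ 1) (hC : ∀ t < T, ∀ x ∈ C t, ∀ i, |x i| ≤ 1)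
    {best : Finset (Fin d → ℝ) → ℝ} (hbest : ∀ t < T, |best (C t)| ≤ m)
    (hmk : 0 < T → m ≤ k)
    (hreg : 0 < m → μ {ω | 4 * k * (∑ t ∈ Finset.range T, ∑ x ∈ P t ω,
      min 1 (width m γ δ (fun s => P s ω) t x) + m * Real.log (2 / δ)) <
        regret β best T C (fun t => P t ω)} ≤ ENNReal.ofReal δ) :
    RegretAtMost μ (fun ω => regret β best T C (fun t => P t ω)) T δ
      (24 * (d * k * m * √(γ * T) * Real.log ((1 + m * T) / δ))) := by
  have hae := h.ae_abs_regret_le hbest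
  -- In the degenerate cases the claimed bound is zero, but so is the regret, almost surely.
  by_cases hmT : m = 0 ∨ T = 0
  · have hB : 24 * (d * k * m * √(γ * T) * Real.log ((1 + m * T) / δ)) = 0 := by
      rcases hmT with rfl | rfl <;> simp
    have hb : (2 * m * T : ℝ) = 0 := by rcases hmT with rfl | rfl <;> simp
    rw [hb] at hae
    refine regretAtMost_of_measure_le (h.measurable_regret best) hδ.le le_rfl hae le_rfl hB.ge ?_
      (fun _ => by rw [hB, zero_mul, add_zero])
    refine le_trans (le_of_eq ?_) zero_le
    rw [measure_eq_zero_iff_ae_notMem]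
    filter_upwards [hae] with ω hω
    exact not_lt.2 (abs_le.1 hω).2
  · rw [not_or] at hmT
    have hm : 0 < m := Nat.pos_of_ne_zero hmT.1
    have hT : 0 < T := Nat.pos_of_ne_zero hmT.2
    have hk : 0 < k := hm.trans_le (hmk hT)
    obtain ⟨hΛ, hΛ2⟩ := half_le_log hm hT hδ hδ1
    set Λ := Real.log ((1 + m * T) / δ) with hΛdef
    have hd1 : (1 : ℝ) ≤ d := by exact_mod_cast hd
    have hk1 : (1 : ℝ) ≤ k := by exact_mod_cast hk
    have hm1 : (1 : ℝ) ≤ m := by exact_mod_cast hm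
    have hT1 : (1 : ℝ) ≤ T := by exact_mod_cast hT
    have hγT : √T ≤ √(γ * T) := Real.sqrt_le_sqrt (by nlinarith)
    have hsT1 : 1 ≤ √T := Real.one_le_sqrt.2 hT1
    have hΛ0 : 0 < Λ := by linarith
    -- The factor `20` is `4 (4 + 1)`: the width sum contributes `4`, the logarithm `1`. The
    -- remaining `4` covers the bad event, where `δ T ≤ √T` and `Λ ≥ 1/2` give `2 m T δ ≤ 4 d k m
    -- √(γT) Λ`.
    refine regretAtMost_of_measure_le (b := 2 * m * T)
      (B' := 20 * (d * k * m * √(γ * T) * Λ)) (h.measurable_regret best) hδ.le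
      (by positivity) hae (by positivity) (by gcongr; norm_num) ?_ ?_
    · refine le_trans (measure_mono_ae ?_) (hreg hm)
      filter_upwards [h.ae_card_le] with ω hω hlt
      refine lt_of_le_of_lt ?_ hlt
      have h1 := sum_min_one_width_le (P := fun s => P s ω) hd hm hT hγ hδ hδ1 hω
        (fun t ht x hx => hC t ht x (h.pick_subset t ht ω hx))
      have h2 : m * Real.log (2 / δ) ≤ d * m * √(γ * T) * Λ := by
        calc m * Real.log (2 / δ) ≤ m * Λ := by gcongr
          _ = 1 * m * 1 * Λ := by ring
          _ ≤ d * m * √(γ * T) * Λ := by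
            gcongr
            exact hsT1.trans hγT
      calc 4 * (k : ℝ) * (∑ t ∈ Finset.range T, ∑ x ∈ P t ω,
            min 1 (width m γ δ (fun s => P s ω) t x) + m * Real.log (2 / δ))
          ≤ 4 * k * (4 * (d * m * √(γ * T) * Λ) + d * m * √(γ * T) * Λ) := by gcongr
        _ = 20 * (d * k * m * √(γ * T) * Λ) := by ring
    · intro hδT
      have h1 : δ * T ≤ √T := by
        have : (T : ℝ) = √T * √T := (Real.mul_self_sqrt (by positivity)).symm
        calc δ * T = δ * √T * √T := by rw [mul_assoc, ← this]
          _ ≤ 1 * √T := by gcongr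
          _ = √T := one_mul _
      have h2 : 2 * m * T * δ ≤ 4 * (d * k * m * √(γ * T) * Λ) := by
        calc 2 * m * T * δ = 2 * m * (δ * T) := by ring
          _ ≤ 2 * m * √(γ * T) := by gcongr; exact h1.trans hγT
          _ = 4 * (1 * 1 * m * √(γ * T) * (1 / 2)) := by ring
          _ ≤ 4 * (d * k * m * √(γ * T) * Λ) := by gcongr
      linarith

theorem Confident.mem_interval {m : ℕ} {γ δ : ℝ} {P : ℕ → Finset (Fin d → ℝ)}
    {y : ℕ → (Fin d → ℝ) → ℝ} (h : Confident m T γ δ β C P y) {t : ℕ} (ht : t < T)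
    {x : Fin d → ℝ} (hx : x ∈ C t) :
    ridge γ P y t ⬝ᵥ x - width m γ δ P t x ≤ β ⬝ᵥ x ∧
      β ⬝ᵥ x ≤ ridge γ P y t ⬝ᵥ x + width m γ δ P t x := by
  have := abs_le.1 (h t ht x hx)
  constructor <;> linarith

/-- On the confidence event each round costs at most `2k` times a conditional mean; the
concentration inequality contributes a further factor `2` and the logarithmic term. -/
theorem IsInteraction.measure_regret_exact_le {m k : ℕ} {γ δ : ℝ}
    (h : IsInteraction (ridgeFair m true γ δ) β T C μ P Y) (hd : 0 < d) (hm : 0 < m)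
    (hγ : 1 ≤ γ) (hδ : 0 < δ) (hδ1 : δ ≤ 1) (hβ : ∀ i, |β i| ≤ 1)
    (hβγ : γ = 1 ∨ ∑ i, β i ^ 2 ≤ 1) (hC : ∀ t < T, ∀ x ∈ C t, ∀ i, |x i| ≤ 1)
    (hk : ∀ t < T, (C t).card ≤ k) (hmC : ∀ t < T, m ≤ (C t).card) :
    μ {ω | 4 * k * (∑ t ∈ Finset.range T, ∑ x ∈ P t ω,
      min 1 (width m γ δ (fun s => P s ω) t x) + m * Real.log (2 / δ)) <
        regret β (bestExact β m) T C (fun t => P t ω)} ≤ ENNReal.ofReal δ := by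
  have hm0 : (0 : ℝ) < m := by exact_mod_cast hm
  set S : ℕ → Finset (Fin d → ℝ) → Ω → ℝ := fun t A ω =>
    ∑ x ∈ A, min 1 (width m γ δ (fun s => P s ω) t x) with hS
  have hS0 : ∀ t A ω, 0 ≤ S t A ω := fun t A ω =>
    Finset.sum_nonneg fun x _ => le_min zero_le_one (width_nonneg _ _ _ _ _ _)
  have hSm : ∀ t A ω, A.card ≤ m → S t A ω ≤ m := fun t A ω hA => by
    calc S t A ω ≤ ∑ _x ∈ A, (1 : ℝ) := Finset.sum_le_sum fun x _ => min_le_left _ _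
      _ = A.card := by simp
      _ ≤ m := by exact_mod_cast hA
  -- Dividing by `m` brings the width sum of a batch into `[0,1]`. The outer truncation acts only on
  -- sets of more than `m` arms, which are never in the support.
  set f : ℕ → Finset (Fin d → ℝ) → Ω → ℝ := fun t A ω => min 1 (S t A ω / m) with hf
  have hconc := h.measure_sum_condMean_le (f := f)
    (fun t ht A => measurable_const.min ((Finset.measurable_sum _ fun x _ =>
      measurable_const.min (measurable_width t x)).div_const _))
    (fun t A ω => le_min zero_le_one (div_nonneg (hS0 t A ω) hm0.le))
    (fun t A ω => min_le_left _ _) hδ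
  have hconf := h.measure_not_confident_le hd hm hγ hδ hδ1 hβ hβγ hC
  have hδsum : ENNReal.ofReal δ = ENNReal.ofReal (δ / 2) + ENNReal.ofReal (δ / 2) := by
    rw [← ENNReal.ofReal_add (by positivity) (by positivity)]
    congr 1
    ring
  rw [hδsum]
  refine le_trans ?_ (add_le_add hconf hconc)
  refine le_trans (measure_mono_ae ?_) (measure_union_le _ _)
  filter_upwards [h.ae_mem_support] with ω hω hlt
  by_contra hgood
  have hgood' : ¬ (ω ∈ {ω | ¬ Confident m T γ δ β C (fun s => P s ω) (fun s x => Y s x ω)} ∨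
    ω ∈ {ω | 2 * ∑ t ∈ Finset.range T, f t (P t ω) ω + 2 * Real.log (2 / δ) <
      ∑ t ∈ Finset.range T, ∑ A ∈ (C t).powerset, (ridgeFair m true γ δ C (fun s => P s ω)
        (fun s x => Y s x ω) t A).toReal * f t A ω}) := hgood
  simp only [Set.mem_ofPred_eq, not_or, not_not, not_lt] at hgood'
  obtain ⟨hcon, hsum⟩ := hgood'
  refine absurd hlt (not_lt.2 ?_)
  set p := fun t => ridgeFair m true γ δ C (fun s => P s ω) (fun s x => Y s x ω) t with hp
  have hround : ∀ t < T, bestExact β m (C t) - setReward β (P t ω) ≤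
      2 * k * (m * ∑ A ∈ (C t).powerset, (p t A).toReal * f t A ω) := by
    intro t ht
    obtain ⟨B, hBC, hBm, hBeq⟩ := exists_bestExact_eq (β := β) (hmC t ht)
    have h1 := sum_le_of_mem_support_pick_true
      (v := fun x => β ⬝ᵥ x) (w := fun x => width m γ δ (fun s => P s ω) t x)
      (fun x => by ring) (fun x => width_nonneg _ _ _ _ _ _)
      (fun x hx => h.abs_mean_le_one ht hx) (fun x hx => hcon.mem_interval ht hx)
      (hmC t ht) (hω t ht) hBC hBm
    have h2 := sum_marginal_mul (C := C t) (p := p t)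
      (fun A hA => subset_of_mem_support_pick m true (ridgeFair_interval m γ δ _ _ t) hA)
      (fun x => min 1 (width m γ δ (fun s => P s ω) t x))
    have h3 : ∑ A ∈ (C t).powerset, (p t A).toReal * S t A ω =
        m * ∑ A ∈ (C t).powerset, (p t A).toReal * f t A ω := by
      rw [Finset.mul_sum]
      refine Finset.sum_congr rfl fun A _ => ?_
      by_cases hA : p t A = 0
      · simp [hA]
      · have hAm := card_le_of_mem_support_pick m true (ridgeFair_interval m γ δ _ _ t)
          ((PMF.mem_support_iff _ _).2 hA)
        have h4 : f t A ω = S t A ω / m :=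
          min_eq_right (div_le_one_of_le₀ (hSm t A ω hAm) hm0.le)
        rw [h4]
        field_simp
    have h5 : ∑ x ∈ C t, (marginal (p t) x).toReal *
        min 1 (width m γ δ (fun s => P s ω) t x) =
        m * ∑ A ∈ (C t).powerset, (p t A).toReal * f t A ω := h2.trans h3
    have h6 : ∑ x ∈ B, β ⬝ᵥ x ≤ ∑ x ∈ P t ω, β ⬝ᵥ x + 2 * (C t).card *
      ∑ x ∈ C t, (marginal (p t) x).toReal * min 1 (width m γ δ (fun s => P s ω) t x) := h1
    have h7 : 0 ≤ ∑ x ∈ C t, (marginal (p t) x).toReal *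
        min 1 (width m γ δ (fun s => P s ω) t x) := Finset.sum_nonneg fun x _ =>
      mul_nonneg ENNReal.toReal_nonneg (le_min zero_le_one (width_nonneg _ _ _ _ _ _))
    have hkt : ((C t).card : ℝ) ≤ k := by exact_mod_cast hk t ht
    rw [hBeq, setReward, setReward, ← h5]
    have h8 : 2 * ((C t).card : ℝ) * ∑ x ∈ C t, (marginal (p t) x).toReal *
        min 1 (width m γ δ (fun s => P s ω) t x) ≤ 2 * k * ∑ x ∈ C t, (marginal (p t) x).toReal *
        min 1 (width m γ δ (fun s => P s ω) t x) := by gcongr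
    linarith
  have hfS : m * ∑ t ∈ Finset.range T, f t (P t ω) ω ≤ ∑ t ∈ Finset.range T, S t (P t ω) ω := by
    rw [Finset.mul_sum]
    refine Finset.sum_le_sum fun t _ => ?_
    calc m * f t (P t ω) ω ≤ m * (S t (P t ω) ω / m) := by
          gcongr
          exact min_le_right _ _
      _ = S t (P t ω) ω := by field_simp
  calc regret β (bestExact β m) T C (fun t => P t ω)
      ≤ ∑ t ∈ Finset.range T, 2 * k * (m * ∑ A ∈ (C t).powerset, (p t A).toReal * f t A ω) :=
        Finset.sum_le_sum fun t ht => hround t (Finset.mem_range.1 ht)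
    _ = 2 * k * (m * ∑ t ∈ Finset.range T, ∑ A ∈ (C t).powerset, (p t A).toReal * f t A ω) := by
        simp only [Finset.mul_sum]
    _ ≤ 2 * k * (m * (2 * ∑ t ∈ Finset.range T, f t (P t ω) ω + 2 * Real.log (2 / δ))) := by
        gcongr
    _ = 4 * k * (m * ∑ t ∈ Finset.range T, f t (P t ω) ω + m * Real.log (2 / δ)) := by ring
    _ ≤ _ := by gcongr

/-- Here the picked set itself pays for its error, so the confidence event suffices. The bound is
weakened from `2k` to `4k`, with the logarithm added, to share `IsInteraction.regretAtMost` with the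
exact mode. -/
theorem IsInteraction.measure_regret_unconstrained_le {k : ℕ} {γ δ : ℝ}
    (h : IsInteraction (ridgeFair k false γ δ) β T C μ P Y) (hd : 0 < d) (hk0 : 0 < k)
    (hγ : 1 ≤ γ) (hδ : 0 < δ) (hδ1 : δ ≤ 1) (hβ : ∀ i, |β i| ≤ 1)
    (hβγ : γ = 1 ∨ ∑ i, β i ^ 2 ≤ 1) (hC : ∀ t < T, ∀ x ∈ C t, ∀ i, |x i| ≤ 1)
    (hk : ∀ t < T, (C t).card ≤ k) :
    μ {ω | 4 * k * (∑ t ∈ Finset.range T, ∑ x ∈ P t ω,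
      min 1 (width k γ δ (fun s => P s ω) t x) + k * Real.log (2 / δ)) <
        regret β (bestUnconstrained β) T C (fun t => P t ω)} ≤ ENNReal.ofReal δ := by
  have hconf := h.measure_not_confident_le hd hk0 hγ hδ hδ1 hβ hβγ hC
  refine le_trans ?_ (hconf.trans (ENNReal.ofReal_le_ofReal (by linarith)))
  refine measure_mono_ae ?_
  filter_upwards [h.ae_mem_support] with ω hω hlt hcon
  refine absurd hlt (not_lt.2 ?_)
  have hround : ∀ t < T, bestUnconstrained β (C t) - setReward β (P t ω) ≤
      2 * k * ∑ x ∈ P t ω, min 1 (width k γ δ (fun s => P s ω) t x) := by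
    intro t ht
    obtain ⟨B, hBC, hBeq⟩ := exists_bestUnconstrained_eq (β := β) (C := C t)
    have h1 := sum_le_of_mem_support_pick_false
      (v := fun x => β ⬝ᵥ x) (w := fun x => width k γ δ (fun s => P s ω) t x)
      (fun x => by ring) (fun x => width_nonneg _ _ _ _ _ _)
      (fun x hx => h.abs_mean_le_one ht hx) (fun x hx => hcon.mem_interval ht hx)
      (hk t ht) (hω t ht) hBC
    have h7 : 0 ≤ ∑ x ∈ P t ω, min 1 (width k γ δ (fun s => P s ω) t x) :=
      Finset.sum_nonneg fun x _ => le_min zero_le_one (width_nonneg _ _ _ _ _ _)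
    have hkt : ((C t).card : ℝ) ≤ k := by exact_mod_cast hk t ht
    rw [hBeq, setReward, setReward]
    have h8 : 2 * ((C t).card : ℝ) * ∑ x ∈ P t ω, min 1 (width k γ δ (fun s => P s ω) t x) ≤
        2 * k * ∑ x ∈ P t ω, min 1 (width k γ δ (fun s => P s ω) t x) := by gcongr
    linarith
  have hlog : 0 ≤ Real.log (2 / δ) := Real.log_nonneg (by
    rw [le_div_iff₀ hδ]
    linarith)
  have hsum : 0 ≤ ∑ t ∈ Finset.range T, ∑ x ∈ P t ω,
      min 1 (width k γ δ (fun s => P s ω) t x) := Finset.sum_nonneg fun t _ =>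
    Finset.sum_nonneg fun x _ => le_min zero_le_one (width_nonneg _ _ _ _ _ _)
  have hk1 : (0 : ℝ) < k := by exact_mod_cast hk0
  calc regret β (bestUnconstrained β) T C (fun t => P t ω)
      ≤ ∑ t ∈ Finset.range T, 2 * k * ∑ x ∈ P t ω, min 1 (width k γ δ (fun s => P s ω) t x) :=
        Finset.sum_le_sum fun t ht => hround t (Finset.mem_range.1 ht)
    _ = 2 * k * (∑ t ∈ Finset.range T, ∑ x ∈ P t ω,
          min 1 (width k γ δ (fun s => P s ω) t x) + 0) := by
        rw [← Finset.mul_sum, add_zero]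
    _ ≤ _ := by
        gcongr
        · norm_num
        · positivity

theorem fairRun_ridgeFair {m : ℕ} (exact : Bool) {γ δ : ℝ} {P : ℕ → Finset (Fin d → ℝ)}
    {y : ℕ → (Fin d → ℝ) → ℝ} (h : Confident m T γ δ β C P y) :
    FairRun (ridgeFair m exact γ δ) β T C P y := fun t ht _ hx _ hx' hβ =>
  marginal_pick_le m exact (ridgeFair_interval m γ δ P y t) hx
    ((h.mem_interval ht hx').1.trans (hβ.trans (h.mem_interval ht hx).2))

/-- Treated separately because the confidence bound is proved for `m > 0`; with no capacity all
marginals vanish. -/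
theorem fairRun_ridgeFair_zero (exact : Bool) (γ δ : ℝ) (P : ℕ → Finset (Fin d → ℝ))
    (y : ℕ → (Fin d → ℝ) → ℝ) : FairRun (ridgeFair 0 exact γ δ) β T C P y := by
  intro t _ x _ x' _ _
  have : ridgeFair 0 exact γ δ C P y t = PMF.pure ∅ := by
    rw [ridgeFair, pick, pickLoop, dif_neg (by simp)]
  rw [this, marginal_pure_of_not_mem (Finset.notMem_empty x')]
  exact zero_le

end Regret

end FairBandit

end

/-! ### Fairness and regret of RidgeFair -/

open FairBandit in
theorem mainTheorem1 :
    -- RidgeFair is fair with probability at least `1 - δ`, in both modes.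
    (∀ (d m T : ℕ) (exact : Bool) (γ δ : ℝ) (β : Fin d → ℝ) (C : ℕ → Finset (Fin d → ℝ))
      (Ω : Type*) [MeasurableSpace Ω] (μ : MeasureTheory.Measure Ω)
      [MeasureTheory.IsProbabilityMeasure μ]
      (P : ℕ → Ω → Finset (Fin d → ℝ)) (Y : ℕ → (Fin d → ℝ) → Ω → ℝ),
      0 < d → 1 ≤ γ → 0 < δ → δ ≤ 1 →
      (∀ i, |β i| ≤ 1) → (γ = 1 ∨ ∑ i, β i ^ 2 ≤ 1) →
      (∀ t < T, ∀ x ∈ C t, ∀ i, |x i| ≤ 1) →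
      IsInteraction (ridgeFair m exact γ δ) β T C μ P Y →
      μ {ω | ¬ FairRun (ridgeFair m exact γ δ) β T C (fun s => P s ω) (fun s x => Y s x ω)}
        ≤ ENNReal.ofReal δ) ∧
    -- The regret bounds, with a universal constant `K`.
    ∃ K : ℝ, 0 < K ∧
      ∀ (d k T : ℕ) (γ δ : ℝ) (β : Fin d → ℝ) (C : ℕ → Finset (Fin d → ℝ))
        (Ω : Type*) [MeasurableSpace Ω] (μ : MeasureTheory.Measure Ω)
        [MeasureTheory.IsProbabilityMeasure μ]
        (P : ℕ → Ω → Finset (Fin d → ℝ)) (Y : ℕ → (Fin d → ℝ) → Ω → ℝ),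
        0 < d → 1 ≤ γ → 0 < δ → δ ≤ 1 →
        (∀ i, |β i| ≤ 1) → (γ = 1 ∨ ∑ i, β i ^ 2 ≤ 1) →
        (∀ t < T, ∀ x ∈ C t, ∀ i, |x i| ≤ 1) →
        (∀ t < T, (C t).card ≤ k) →
        -- exactly `m` arms are picked in every round
        (∀ m : ℕ, (∀ t < T, m ≤ (C t).card) →
          IsInteraction (ridgeFair m true γ δ) β T C μ P Y →
          RegretAtMost μ (fun ω => regret β (bestExact β m) T C (fun t => P t ω)) T δ
            (K * (d * k * m * √(γ * T) * Real.log ((1 + m * T) / δ)))) ∧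
        -- the number of arms picked is unconstrained
        (IsInteraction (ridgeFair k false γ δ) β T C μ P Y →
          RegretAtMost μ (fun ω => regret β (bestUnconstrained β) T C (fun t => P t ω)) T δ
            (K * (d * (k : ℝ) ^ 2 * √(γ * T) * Real.log ((1 + k * T) / δ)))) := by
  refine ⟨?_, 24, by norm_num, ?_⟩
  · intro d m T exact γ δ β C Ω _ μ _ P Y hd hγ hδ hδ1 hβ hβγ hC h
    rcases Nat.eq_zero_or_pos m with rfl | hm
    · simp [fairRun_ridgeFair_zero]
    · refine le_trans (MeasureTheory.measure_mono ?_)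
        ((h.measure_not_confident_le hd hm hγ hδ hδ1 hβ hβγ hC).trans
          (ENNReal.ofReal_le_ofReal (by linarith)))
      exact fun ω hω hcon => hω (fairRun_ridgeFair exact hcon)
  · intro d k T γ δ β C Ω _ μ _ P Y hd hγ hδ hδ1 hβ hβγ hC hk
    refine ⟨fun m hmC h => ?_, fun h => ?_⟩
    · refine h.regretAtMost hd hγ hδ hδ1 hC (fun t ht => ?_)
        (fun hT => (hmC 0 hT).trans (hk 0 hT))
        (fun hm => h.measure_regret_exact_le hd hm hγ hδ hδ1 hβ hβγ hC hk hmC)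
      obtain ⟨A, hA, hAm, hAeq⟩ := exists_bestExact_eq (β := β) (hmC t ht)
      rw [hAeq]
      exact abs_setReward_le (fun x hx => h.abs_mean_le_one ht (hA hx)) hAm.le
    · have hreg := h.regretAtMost (best := bestUnconstrained β) (k := k) hd hγ hδ hδ1 hC
        (fun t ht => ?_) (fun _ => le_rfl)
        (fun hk0 => h.measure_regret_unconstrained_le hd hk0 hγ hδ hδ1 hβ hβγ hC hk)
      · have heq : (d : ℝ) * k * k = d * (k : ℝ) ^ 2 := by ring
        rwa [heq] at hreg
      · obtain ⟨A, hA, hAeq⟩ := exists_bestUnconstrained_eq (β := β) (C := C t)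
        rw [hAeq]
        exact abs_setReward_le (fun x hx => h.abs_mean_le_one ht (hA hx))
          ((Finset.card_le_card hA).trans (hk t ht))
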